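/- Conventions. All algebras are over $\mathbb{C}$ and $\otimes$ is the algebraic tensor product. For an algebra $\mathscr{B}$ with non-degenerate product, $M(\mathscr{B})$ denotes its multiplier algebra. For such $\mathscr{B}_1,\mathscr{B}_2$ the algebra $M(\mathscr{B}_1)\otimes M(\mathscr{B}_2)$ is regarded as a subalgebra of $M(\mathscr{B}_1\otimes\mathscr{B}_2)$. A discrete quantum group is a pair $(\mathscr{A},\delta)$ where $\mathscr{A}$ is a $*$-algebra which, as an algebra, is isomorphic to a direct sum of full matrix algebras $M_{n_\iota}(\mathbb{C})$, and $\delta\colon\mathscr{A}\to M(\mathscr{A}\otimes\mathscr{A})$ is a $*$-homomorphism such that $T_1(a\otimes b)=\delta(a)(I\otimes b)$ and $T_2(a\otimes b)=(a\otimes I)\delta(b)$ define bijections $T_1,T_2$ of $\mathscr{A}\otimes\mathscr{A}$ onto itself, and such that $T_2\otimes\mathrm{id}$ and $\mathrm{id}\otimes T_1$ commute on $\mathscr{A}\otimes\mathscr{A}\otimes\mathscr{A}$. Then $\delta$ is non-degenerate; its unique extension to a homomorphism of unital algebras $M(\mathscr{A})\to M(\mathscr{A}\otimes\mathscr{A})$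 is again denoted by $\delta$. The algebra of almost periodic elements is $$\mathscr{AP}=\{x\in M(\mathscr{A}) : \delta(x)\in M(\mathscr{A})\otimes M(\mathscr{A})\}.$$ The counit is the multiplicative functional $\varepsilon$ on $\mathscr{A}$ with $(\mathrm{id}\otimes\varepsilon)\bigl((a\otimes I)\delta(b)\bigr)=ab=(\varepsilon\otimes\mathrm{id})\bigl(\delta(a)(I\otimes b)\bigr)$ for all $a,b\in\mathscr{A}$. The coinverse is the linear antihomomorphism $\kappa\colon\mathscr{A}\to M(\mathscr{A})$ such that, with $m$ denoting multiplication, for all $a,b,c\in\mathscr{A}$ $$m\bigl[(\mathrm{id}\otimes\kappa)\bigl((a\otimes I)\delta(b)\bigr)(I\otimes c)\bigr]=a\,\varepsilon(b)\,c,\qquad m\bigl[(a\otimes I)(\kappa\otimes\mathrm{id})\bigl(\delta(b)(I\otimes c)\bigr)\bigr]=a\,\varepsilon(b)\,c.$$ **Theorem.** Let $(\mathscr{A},\delta)$ be a discrete quantum group. Then $\mathscr{AP}$ is a unital $*$-subalgebra of $M(\mathscr{A})$. Moreover: 1. $\delta(\mathscr{AP})\subset\mathscr{AP}\otimes\mathscr{AP}$;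 2. the counit $\varepsilon$ and the coinverse $\kappa$ exist and are unique, $\kappa$ extends uniquely to an algebra antiisomorphism $\kappa\colon M(\mathscr{A})\to M(\mathscr{A})$, and $\kappa(\mathscr{AP})=\mathscr{AP}$. -/

import Mathlib

open scoped TensorProduct

noncomputable section

set_option linter.unusedSectionVars false

universe u v

/-- The product of an algebra is non-degenerate: `a b = 0` for all `b` implies `a = 0`, and
`b a = 0` for all `b` implies `a = 0`. -/
structure NondegenerateProduct (A : Type u) [NonUnitalRing A] : Prop where
  eq_zero_of_mul_right : ∀ a : A, (∀ b, a * b = 0) → a = 0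
  eq_zero_of_mul_left : ∀ a : A, (∀ b, b * a = 0) → a = 0

section MultiplierAlgebra

variable (A : Type u) [NonUnitalRing A] [Module ℂ A] [IsScalarTower ℂ A A] [SMulCommClass ℂ A A]

/-- The pairs `(L, R)` of linear maps `A → A` with `a * L b = R a * b`. The second component is
taken in the opposite algebra because right multiplications compose in the reverse order. -/
def multiplierSubalgebra :
    Subalgebra ℂ (Module.End ℂ A × (Module.End ℂ A)ᵐᵒᵖ) where
  carrier := {p | ∀ a b : A, a * p.1 b = p.2.unop a * b}
  mul_mem' := by
    intro p q hp hq a b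
    simp only [Set.mem_ofPred_eq] at hp hq
    simp [Module.End.mul_apply, hp, hq]
  add_mem' := by
    intro p q hp hq a b
    simp only [Set.mem_ofPred_eq] at hp hq
    simp [mul_add, add_mul, hp, hq]
  algebraMap_mem' := by
    intro r a b
    exact (mul_smul_comm r a b).trans (smul_mul_assoc r a b).symm

/-- The multiplier algebra `M(A)` of an algebra `A`. -/
def Multiplier : Type u := multiplierSubalgebra A

instance : Ring (Multiplier A) := inferInstanceAs (Ring (multiplierSubalgebra A))

instance : Algebra ℂ (Multiplier A) := inferInstanceAs (Algebra ℂ (multiplierSubalgebra A))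

end MultiplierAlgebra

namespace Multiplier

section Basic

variable {A : Type u} [NonUnitalRing A] [Module ℂ A] [IsScalarTower ℂ A A] [SMulCommClass ℂ A A]

/-- Left multiplication by a multiplier: `m.left a = m a`. -/
def left (m : Multiplier A) : A →ₗ[ℂ] A := m.1.1

/-- Right multiplication by a multiplier: `m.right a = a m`. -/
def right (m : Multiplier A) : A →ₗ[ℂ] A := m.1.2.unop

theorem central (m : Multiplier A) (a b : A) : a * m.left b = m.right a * b := m.2 a b

/-- The multiplier with given left and right multiplication maps. -/
def mk (L R : A →ₗ[ℂ] A) (h : ∀ a b, a * L b = R a * b) : Multiplier A :=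
  ⟨(L, MulOpposite.op R), h⟩

@[simp] theorem left_mk (L R : A →ₗ[ℂ] A) (h) : (mk L R h).left = L := rfl
@[simp] theorem right_mk (L R : A →ₗ[ℂ] A) (h) : (mk L R h).right = R := rfl

theorem ext' {m n : Multiplier A} (hl : m.left = n.left) (hr : m.right = n.right) : m = n :=
  Subtype.ext (Prod.ext hl (MulOpposite.unop_injective hr))

@[simp] theorem left_mul (m n : Multiplier A) (a : A) : (m * n).left a = m.left (n.left a) := rfl
@[simp] theorem right_mul (m n : Multiplier A) (a : A) :
    (m * n).right a = n.right (m.right a) := rfl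
@[simp] theorem left_one (a : A) : (1 : Multiplier A).left a = a := rfl
@[simp] theorem right_one (a : A) : (1 : Multiplier A).right a = a := rfl
@[simp] theorem left_add (m n : Multiplier A) (a : A) : (m + n).left a = m.left a + n.left a := rfl
@[simp] theorem right_add (m n : Multiplier A) (a : A) :
    (m + n).right a = m.right a + n.right a := rfl
@[simp] theorem left_zero (a : A) : (0 : Multiplier A).left a = 0 := rfl
@[simp] theorem right_zero (a : A) : (0 : Multiplier A).right a = 0 := rfl
@[simp] theorem left_smul (c : ℂ) (m : Multiplier A) (a : A) : (c • m).left a = c • m.left a := rfl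
@[simp] theorem right_smul (c : ℂ) (m : Multiplier A) (a : A) :
    (c • m).right a = c • m.right a := rfl

/-- `m.left` as a linear function of the multiplier `m`. -/
def leftₗ : Multiplier A →ₗ[ℂ] A →ₗ[ℂ] A where
  toFun := left
  map_add' _ _ := rfl
  map_smul' _ _ := rfl

/-- `m.right` as a linear function of the multiplier `m`. -/
def rightₗ : Multiplier A →ₗ[ℂ] A →ₗ[ℂ] A where
  toFun := right
  map_add' _ _ := rfl
  map_smul' _ _ := rfl

/-- The canonical homomorphism `A → M(A)`. -/
def incl : A →ₙₐ[ℂ] Multiplier A where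
  toFun a := mk (LinearMap.mulLeft ℂ a) (LinearMap.mulRight ℂ a) fun x y => by
    simp [mul_assoc]
  map_zero' := ext' (LinearMap.ext fun x => zero_mul x) (LinearMap.ext fun x => mul_zero x)
  map_add' a b := ext' (LinearMap.ext fun x => add_mul a b x)
    (LinearMap.ext fun x => mul_add x a b)
  map_mul' a b := ext' (LinearMap.ext fun x => mul_assoc a b x)
    (LinearMap.ext fun x => (mul_assoc x a b).symm)
  map_smul' c a := ext' (LinearMap.ext fun x => smul_mul_assoc c a x)
    (LinearMap.ext fun x => mul_smul_comm c x a)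

@[simp] theorem left_incl (a b : A) : (incl a).left b = a * b := rfl
@[simp] theorem right_incl (a b : A) : (incl a).right b = b * a := rfl

theorem eq_of_left (hA : NondegenerateProduct A) {m n : Multiplier A} (h : m.left = n.left) :
    m = n := by
  refine ext' h (LinearMap.ext fun a => sub_eq_zero.1 (hA.eq_zero_of_mul_right _ fun b => ?_))
  rw [sub_mul, ← central, ← central, h, sub_self]

theorem left_mul_apply (hA : NondegenerateProduct A) (m : Multiplier A) (a b : A) :
    m.left (a * b) = m.left a * b :=
  sub_eq_zero.1 (hA.eq_zero_of_mul_left _ fun c => by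
    rw [mul_sub, central, ← mul_assoc, ← mul_assoc, central, sub_self])

theorem right_mul_apply (hA : NondegenerateProduct A) (m : Multiplier A) (a b : A) :
    m.right (a * b) = a * m.right b :=
  sub_eq_zero.1 (hA.eq_zero_of_mul_right _ fun c => by
    rw [sub_mul, ← central, mul_assoc, mul_assoc, ← central, sub_self])

theorem mul_incl (hA : NondegenerateProduct A) (m : Multiplier A) (a : A) :
    m * incl a = incl (m.left a) :=
  eq_of_left hA (LinearMap.ext fun b => by simp [left_mul_apply hA])

theorem incl_mul (hA : NondegenerateProduct A) (m : Multiplier A) (a : A) :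
    incl a * m = incl (m.right a) :=
  eq_of_left hA (LinearMap.ext fun b => by simp [central])

end Basic

section StarStructure

variable {A : Type u} [NonUnitalRing A] [Module ℂ A] [IsScalarTower ℂ A A] [SMulCommClass ℂ A A]
  [StarRing A] [StarModule ℂ A]

/-- The involution of `M(A)`: `m* a = (a* m)*` and `a m* = (m a*)*`. -/
instance : Star (Multiplier A) where
  star m := mk
    { toFun := fun a => star (m.right (star a))
      map_add' := by simp
      map_smul' := by simp [star_smul] }
    { toFun := fun a => star (m.left (star a))
      map_add' := by simp
      map_smul' := by simp [star_smul] }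
    fun a b => star_injective (by simp [central])

@[simp] theorem left_star (m : Multiplier A) (a : A) :
    (star m).left a = star (m.right (star a)) := rfl
@[simp] theorem right_star (m : Multiplier A) (a : A) :
    (star m).right a = star (m.left (star a)) := rfl

instance : StarRing (Multiplier A) where
  star_involutive m := ext' (by ext; simp) (by ext; simp)
  star_mul m n := ext' (by ext; simp) (by ext; simp)
  star_add m n := ext' (by ext; simp) (by ext; simp)

instance : StarModule ℂ (Multiplier A) where
  star_smul c m := ext' (by ext; simp [star_smul]) (by ext; simp [star_smul])

end StarStructure

section Tensor

variable {A : Type u} [NonUnitalRing A] [Module ℂ A] [IsScalarTower ℂ A A] [SMulCommClass ℂ A A]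
variable {B : Type v} [NonUnitalRing B] [Module ℂ B] [IsScalarTower ℂ B B] [SMulCommClass ℂ B B]

/-- The multiplier `m ⊗ n` of `A ⊗ B`, for multipliers `m` of `A` and `n` of `B`:
`(m ⊗ n)(a ⊗ b) = m a ⊗ n b` and `(a ⊗ b)(m ⊗ n) = a m ⊗ b n`. -/
def tmul (m : Multiplier A) (n : Multiplier B) : Multiplier (A ⊗[ℂ] B) :=
  mk (TensorProduct.map m.left n.left) (TensorProduct.map m.right n.right) fun s t => by
    induction s with
    | zero => simp
    | add s₁ s₂ h₁ h₂ => simp only [map_add, add_mul, h₁, h₂]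
    | tmul a b =>
      induction t with
      | zero => simp
      | add t₁ t₂ h₁ h₂ => simp only [map_add, mul_add, h₁, h₂]
      | tmul c d => simp [central]

/-- For sets `X ⊆ M(A)`, `Y ⊆ M(B)`, the subspace of `M(A ⊗ B)` spanned by the elements `x ⊗ y`
with `x ∈ X`, `y ∈ Y`. When `X`, `Y` are subspaces this is the algebraic tensor product `X ⊗ Y`,
regarded inside `M(A ⊗ B)`. -/
def algTensor (X : Set (Multiplier A)) (Y : Set (Multiplier B)) :
    Submodule ℂ (Multiplier (A ⊗[ℂ] B)) :=
  Submodule.span ℂ (Set.image2 tmul X Y)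

end Tensor

section Extension

variable {A : Type u} [NonUnitalRing A] [Module ℂ A] [IsScalarTower ℂ A A] [SMulCommClass ℂ A A]
variable {B : Type v} [NonUnitalRing B] [Module ℂ B] [IsScalarTower ℂ B B] [SMulCommClass ℂ B B]

/-- The linear map `a ⊗ b ↦ Φ(x a) b`. -/
def leftMap (Φ : A →ₙₐ[ℂ] Multiplier B) (x : Multiplier A) : A ⊗[ℂ] B →ₗ[ℂ] B :=
  TensorProduct.lift (leftₗ ∘ₗ (Φ : A →ₗ[ℂ] Multiplier B) ∘ₗ x.left)

/-- The linear map `a ⊗ b ↦ b Φ(a x)`. -/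
def rightMap (Φ : A →ₙₐ[ℂ] Multiplier B) (x : Multiplier A) : A ⊗[ℂ] B →ₗ[ℂ] B :=
  TensorProduct.lift (rightₗ ∘ₗ (Φ : A →ₗ[ℂ] Multiplier B) ∘ₗ x.right)

theorem leftMap_tmul (Φ : A →ₙₐ[ℂ] Multiplier B) (x : Multiplier A) (a : A) (b : B) :
    leftMap Φ x (a ⊗ₜ b) = (Φ (x.left a)).left b := rfl

theorem rightMap_tmul (Φ : A →ₙₐ[ℂ] Multiplier B) (x : Multiplier A) (a : A) (b : B) :
    rightMap Φ x (a ⊗ₜ b) = (Φ (x.right a)).right b := rfl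

/-- A homomorphism `Φ : A → M(B)` is non-degenerate if `Φ(A) B = B = B Φ(A)`. -/
structure IsNondegenerate (Φ : A →ₙₐ[ℂ] Multiplier B) : Prop where
  span_left : Submodule.span ℂ {c : B | ∃ (a : A) (b : B), (Φ a).left b = c} = ⊤
  span_right : Submodule.span ℂ {c : B | ∃ (a : A) (b : B), (Φ a).right b = c} = ⊤

theorem leftMap_one_surjective {Φ : A →ₙₐ[ℂ] Multiplier B} (hΦ : IsNondegenerate Φ) :
    Function.Surjective (leftMap Φ 1) := by
  rw [← LinearMap.range_eq_top, eq_top_iff, ← hΦ.span_left, Submodule.span_le]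
  rintro _ ⟨a, b, rfl⟩
  exact ⟨a ⊗ₜ b, rfl⟩

theorem rightMap_one_surjective {Φ : A →ₙₐ[ℂ] Multiplier B} (hΦ : IsNondegenerate Φ) :
    Function.Surjective (rightMap Φ 1) := by
  rw [← LinearMap.range_eq_top, eq_top_iff, ← hΦ.span_right, Submodule.span_le]
  rintro _ ⟨a, b, rfl⟩
  exact ⟨a ⊗ₜ b, rfl⟩

theorem rightMap_mul_leftMap (Φ : A →ₙₐ[ℂ] Multiplier B) (x : Multiplier A) (s t : A ⊗[ℂ] B) :
    rightMap Φ 1 s * leftMap Φ x t = rightMap Φ x s * leftMap Φ 1 t := by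
  induction s with
  | zero => simp
  | add s₁ s₂ h₁ h₂ => simp only [map_add, add_mul, h₁, h₂]
  | tmul a b =>
    induction t with
    | zero => simp
    | add t₁ t₂ h₁ h₂ => simp only [map_add, mul_add, h₁, h₂]
    | tmul c d =>
      simp only [leftMap_tmul, rightMap_tmul, left_one, right_one, ← central, ← left_mul,
        ← map_mul]

theorem ker_leftMap_le (hB : NondegenerateProduct B) {Φ : A →ₙₐ[ℂ] Multiplier B}
    (hΦ : IsNondegenerate Φ) (x : Multiplier A) :
    LinearMap.ker (leftMap Φ 1) ≤ LinearMap.ker (leftMap Φ x) := by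
  intro t ht
  rw [LinearMap.mem_ker] at ht ⊢
  refine hB.eq_zero_of_mul_left _ fun c => ?_
  obtain ⟨s, rfl⟩ := rightMap_one_surjective hΦ c
  rw [rightMap_mul_leftMap, ht, mul_zero]

theorem ker_rightMap_le (hB : NondegenerateProduct B) {Φ : A →ₙₐ[ℂ] Multiplier B}
    (hΦ : IsNondegenerate Φ) (x : Multiplier A) :
    LinearMap.ker (rightMap Φ 1) ≤ LinearMap.ker (rightMap Φ x) := by
  intro s hs
  rw [LinearMap.mem_ker] at hs ⊢
  refine hB.eq_zero_of_mul_right _ fun c => ?_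
  obtain ⟨t, rfl⟩ := leftMap_one_surjective hΦ c
  rw [← rightMap_mul_leftMap, hs, zero_mul]

/-- The linear map `Φ(a) b ↦ Φ(x a) b` on `B`. -/
def extLeft (hB : NondegenerateProduct B) {Φ : A →ₙₐ[ℂ] Multiplier B} (hΦ : IsNondegenerate Φ)
    (x : Multiplier A) : B →ₗ[ℂ] B :=
  (LinearMap.ker (leftMap Φ 1)).liftQ (leftMap Φ x) (ker_leftMap_le hB hΦ x) ∘ₗ
    ((leftMap Φ 1).quotKerEquivOfSurjective (leftMap_one_surjective hΦ)).symm.toLinearMap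

/-- The linear map `b Φ(a) ↦ b Φ(a x)` on `B`. -/
def extRight (hB : NondegenerateProduct B) {Φ : A →ₙₐ[ℂ] Multiplier B} (hΦ : IsNondegenerate Φ)
    (x : Multiplier A) : B →ₗ[ℂ] B :=
  (LinearMap.ker (rightMap Φ 1)).liftQ (rightMap Φ x) (ker_rightMap_le hB hΦ x) ∘ₗ
    ((rightMap Φ 1).quotKerEquivOfSurjective (rightMap_one_surjective hΦ)).symm.toLinearMap

theorem extLeft_leftMap (hB : NondegenerateProduct B) {Φ : A →ₙₐ[ℂ] Multiplier B}
    (hΦ : IsNondegenerate Φ) (x : Multiplier A) (t : A ⊗[ℂ] B) :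
    extLeft hB hΦ x (leftMap Φ 1 t) = leftMap Φ x t := by
  have h : (leftMap Φ 1).quotKerEquivOfSurjective (leftMap_one_surjective hΦ)
      (Submodule.Quotient.mk t) = leftMap Φ 1 t := rfl
  simp only [extLeft, LinearMap.comp_apply, LinearEquiv.coe_coe]
  rw [← h, LinearEquiv.symm_apply_apply]
  rfl

theorem extRight_rightMap (hB : NondegenerateProduct B) {Φ : A →ₙₐ[ℂ] Multiplier B}
    (hΦ : IsNondegenerate Φ) (x : Multiplier A) (t : A ⊗[ℂ] B) :
    extRight hB hΦ x (rightMap Φ 1 t) = rightMap Φ x t := by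
  have h : (rightMap Φ 1).quotKerEquivOfSurjective (rightMap_one_surjective hΦ)
      (Submodule.Quotient.mk t) = rightMap Φ 1 t := rfl
  simp only [extRight, LinearMap.comp_apply, LinearEquiv.coe_coe]
  rw [← h, LinearEquiv.symm_apply_apply]
  rfl

/-- The value at `x ∈ M(A)` of the extension of a non-degenerate homomorphism `Φ : A → M(B)`. -/
def extFun (hB : NondegenerateProduct B) {Φ : A →ₙₐ[ℂ] Multiplier B} (hΦ : IsNondegenerate Φ)
    (x : Multiplier A) : Multiplier B :=
  mk (extLeft hB hΦ x) (extRight hB hΦ x) fun c d => by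
    obtain ⟨s, rfl⟩ := rightMap_one_surjective hΦ c
    obtain ⟨t, rfl⟩ := leftMap_one_surjective hΦ d
    rw [extLeft_leftMap, extRight_rightMap, rightMap_mul_leftMap]

theorem extFun_left (hB : NondegenerateProduct B) {Φ : A →ₙₐ[ℂ] Multiplier B}
    (hΦ : IsNondegenerate Φ) (x : Multiplier A) (a : A) (b : B) :
    (extFun hB hΦ x).left ((Φ a).left b) = (Φ (x.left a)).left b :=
  extLeft_leftMap hB hΦ x (a ⊗ₜ b)

theorem eq_of_left_on_range (hB : NondegenerateProduct B) {Φ : A →ₙₐ[ℂ] Multiplier B}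
    (hΦ : IsNondegenerate Φ) {m n : Multiplier B}
    (h : ∀ (a : A) (b : B), m.left ((Φ a).left b) = n.left ((Φ a).left b)) : m = n := by
  refine eq_of_left hB (LinearMap.ext_on hΦ.span_left ?_)
  rintro _ ⟨a, b, rfl⟩
  exact h a b

/-- The extension of a non-degenerate homomorphism `Φ : A → M(B)` to a homomorphism of unital
algebras `M(A) → M(B)`. -/
def extension (hB : NondegenerateProduct B) {Φ : A →ₙₐ[ℂ] Multiplier B} (hΦ : IsNondegenerate Φ) :
    Multiplier A →ₐ[ℂ] Multiplier B :=
  AlgHom.ofLinearMap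
    { toFun := extFun hB hΦ
      map_add' := fun x y => eq_of_left_on_range hB hΦ fun a b => by simp [extFun_left]
      map_smul' := fun c x => eq_of_left_on_range hB hΦ fun a b => by simp [extFun_left] }
    (eq_of_left_on_range hB hΦ fun a b => by simp [extFun_left])
    (fun x y => eq_of_left_on_range hB hΦ fun a b => by simp [extFun_left])

theorem extension_incl (hB : NondegenerateProduct B) {Φ : A →ₙₐ[ℂ] Multiplier B}
    (hΦ : IsNondegenerate Φ) (a : A) : extension hB hΦ (incl a) = Φ a :=
  eq_of_left_on_range hB hΦ fun c b => by
    change (extFun hB hΦ (incl a)).left _ = _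
    rw [extFun_left, left_incl, map_mul, left_mul]

theorem extension_unique (hA : NondegenerateProduct A) (hB : NondegenerateProduct B)
    {Φ : A →ₙₐ[ℂ] Multiplier B} (hΦ : IsNondegenerate Φ) (Ψ : Multiplier A →ₐ[ℂ] Multiplier B)
    (h : ∀ a, Ψ (incl a) = Φ a) : Ψ = extension hB hΦ :=
  AlgHom.ext fun x => eq_of_left_on_range hB hΦ fun a b => by
    rw [← left_mul, ← left_mul, ← h, ← map_mul, mul_incl hA, h, h, ← extension_incl hB hΦ,
      ← extension_incl hB hΦ, ← map_mul, mul_incl hA]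

end Extension

end Multiplier

section DiscreteQuantumGroups

open Multiplier

/-- The algebra `A` is (isomorphic to) a direct sum of full matrix algebras `M_{n i}`, `i ∈ I`:
it embeds into the product of the `M_{n i}` with image the families of finite support. -/
def IsDirectSumOfMatrixAlgebras (A : Type u) [NonUnitalRing A] [Module ℂ A] : Prop :=
  ∃ (I : Type u) (n : I → ℕ) (π : A →ₙₐ[ℂ] ((i : I) → Matrix (Fin (n i)) (Fin (n i)) ℂ)),
    (∀ i, 0 < n i) ∧ Function.Injective π ∧ Set.range π = {f | {i | f i ≠ 0}.Finite}

variable {A : Type u} [NonUnitalRing A] [Module ℂ A] [IsScalarTower ℂ A A] [SMulCommClass ℂ A A]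

/-- A direct sum of full matrix algebras has local units. -/
theorem IsDirectSumOfMatrixAlgebras.exists_localUnit (hA : IsDirectSumOfMatrixAlgebras A)
    (s : Finset A) : ∃ e : A, ∀ a ∈ s, e * a = a ∧ a * e = a := by
  classical
  obtain ⟨I, n, π, -, hinj, hran⟩ := hA
  let F : Set I := ⋃ a ∈ s, {i | π a i ≠ 0}
  have hF : F.Finite := s.finite_toSet.biUnion fun a _ => by
    have : π a ∈ Set.range π := ⟨a, rfl⟩
    rw [hran] at this
    exact this
  let f : (i : I) → Matrix (Fin (n i)) (Fin (n i)) ℂ := fun i => if i ∈ F then 1 else 0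
  have hf : f ∈ Set.range π := by
    rw [hran]
    refine hF.subset fun i hi => ?_
    by_contra h
    exact hi (if_neg h)
  obtain ⟨e, he⟩ := hf
  have key : ∀ a ∈ s, ∀ i, i ∉ F → π a i = 0 := by
    intro a ha i hi
    by_contra h
    exact hi (Set.mem_biUnion (show a ∈ (s : Set A) from ha) h)
  refine ⟨e, fun a ha => ⟨hinj ?_, hinj ?_⟩⟩
  · rw [map_mul, he]
    funext i
    by_cases hi : i ∈ F
    · simp [f, hi]
    · simp [f, hi, key a ha i hi]
  · rw [map_mul, he]
    funext i
    by_cases hi : i ∈ F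
    · simp [f, hi]
    · simp [f, hi, key a ha i hi]

theorem IsDirectSumOfMatrixAlgebras.exists_tensor_localUnit (hA : IsDirectSumOfMatrixAlgebras A)
    (t : A ⊗[ℂ] A) : ∃ e : A ⊗[ℂ] A, e * t = t ∧ t * e = t := by
  classical
  suffices h : ∃ s : Finset A, ∀ e : A, (∀ a ∈ s, e * a = a ∧ a * e = a) →
      (e ⊗ₜ[ℂ] e) * t = t ∧ t * (e ⊗ₜ[ℂ] e) = t by
    obtain ⟨s, hs⟩ := h
    obtain ⟨e, he⟩ := hA.exists_localUnit s
    exact ⟨e ⊗ₜ e, hs e he⟩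
  induction t with
  | zero => exact ⟨∅, fun e _ => by simp⟩
  | tmul a b =>
    refine ⟨{a, b}, fun e he => ?_⟩
    have h₁ := he a (by simp)
    have h₂ := he b (by simp)
    simp [h₁.1, h₁.2, h₂.1, h₂.2]
  | add t₁ t₂ h₁ h₂ =>
    obtain ⟨s₁, h₁⟩ := h₁
    obtain ⟨s₂, h₂⟩ := h₂
    refine ⟨s₁ ∪ s₂, fun e he => ?_⟩
    have h₁ := h₁ e fun a ha => he a (Finset.mem_union_left _ ha)
    have h₂ := h₂ e fun a ha => he a (Finset.mem_union_right _ ha)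
    simp [mul_add, add_mul, h₁.1, h₁.2, h₂.1, h₂.2]

theorem IsDirectSumOfMatrixAlgebras.nondegenerate_tensor (hA : IsDirectSumOfMatrixAlgebras A) :
    NondegenerateProduct (A ⊗[ℂ] A) where
  eq_zero_of_mul_right t h := by
    obtain ⟨e, -, he⟩ := hA.exists_tensor_localUnit t
    rw [← he, h]
  eq_zero_of_mul_left t h := by
    obtain ⟨e, he, -⟩ := hA.exists_tensor_localUnit t
    rw [← he, h]

section StarTensor

variable [StarRing A] [StarModule ℂ A]

/-- The involution `(a ⊗ b)* = a* ⊗ b*` makes `A ⊗ A` a `*`-algebra. -/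
instance (priority := 50) tensorStarRing : StarRing (A ⊗[ℂ] A) where
  star_mul x y := by
    induction x with
    | zero => simp
    | add x₁ x₂ h₁ h₂ => simp only [add_mul, mul_add, star_add, h₁, h₂]
    | tmul a b =>
      induction y with
      | zero => simp
      | add y₁ y₂ h₁ h₂ => simp only [add_mul, mul_add, star_add, h₁, h₂]
      | tmul c d => simp
  star_add := star_add

end StarTensor

/-- A multiplier Hopf `*`-algebra structure on the `*`-algebra `A`. The maps `T₁`, `T₂` are
determined by the comultiplication `comul` through `T₁_spec`, `T₂_spec`. -/
structure MultiplierHopfStarAlgebra (A : Type u) [NonUnitalRing A] [Module ℂ A]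
    [IsScalarTower ℂ A A] [SMulCommClass ℂ A A] [StarRing A] [StarModule ℂ A] where
  nondegenerate : NondegenerateProduct A
  /-- The comultiplication `δ`. -/
  comul : A →⋆ₙₐ[ℂ] Multiplier (A ⊗[ℂ] A)
  /-- The bijection `a ⊗ b ↦ δ(a)(1 ⊗ b)` of `A ⊗ A`. -/
  T₁ : (A ⊗[ℂ] A) ≃ₗ[ℂ] (A ⊗[ℂ] A)
  /-- The bijection `a ⊗ b ↦ (a ⊗ 1)δ(b)` of `A ⊗ A`. -/
  T₂ : (A ⊗[ℂ] A) ≃ₗ[ℂ] (A ⊗[ℂ] A)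
  T₁_spec : ∀ a b : A, incl (T₁ (a ⊗ₜ b)) = comul a * tmul 1 (incl b)
  T₂_spec : ∀ a b : A, incl (T₂ (a ⊗ₜ b)) = tmul (incl a) 1 * comul b
  /-- Coassociativity: `T₂ ⊗ id` and `id ⊗ T₁` commute. -/
  coassoc : ∀ t : (A ⊗[ℂ] A) ⊗[ℂ] A,
    TensorProduct.assoc ℂ A A A (T₂.toLinearMap.rTensor A
      ((TensorProduct.assoc ℂ A A A).symm (T₁.toLinearMap.lTensor A
        (TensorProduct.assoc ℂ A A A t)))) =
    T₁.toLinearMap.lTensor A (TensorProduct.assoc ℂ A A A (T₂.toLinearMap.rTensor A t))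

/-- A discrete quantum group: a multiplier Hopf `*`-algebra whose underlying algebra is a direct
sum of full matrix algebras. -/
structure DiscreteQuantumGroup (A : Type u) [NonUnitalRing A] [Module ℂ A]
    [IsScalarTower ℂ A A] [SMulCommClass ℂ A A] [StarRing A] [StarModule ℂ A]
    extends MultiplierHopfStarAlgebra A where
  isDirectSum : IsDirectSumOfMatrixAlgebras A

variable [StarRing A] [StarModule ℂ A]

namespace MultiplierHopfStarAlgebra

/-- `ε` is the counit: it is multiplicative, `(id ⊗ ε)((a ⊗ 1)δ(b)) = ab` and
`(ε ⊗ id)(δ(a)(1 ⊗ b)) = ab`. -/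
structure IsCounit (G : MultiplierHopfStarAlgebra A) (ε : A →ₙₐ[ℂ] ℂ) : Prop where
  right : ∀ a b : A,
    TensorProduct.rid ℂ A ((ε : A →ₗ[ℂ] ℂ).lTensor A (G.T₂ (a ⊗ₜ b))) = a * b
  left : ∀ a b : A,
    TensorProduct.lid ℂ A ((ε : A →ₗ[ℂ] ℂ).rTensor A (G.T₁ (a ⊗ₜ b))) = a * b

/-- `κ` is the coinverse: it is an antihomomorphism `A → M(A)` such that
`m[(id ⊗ κ)((a ⊗ 1)δ(b))(1 ⊗ c)] = a ε(b) c` and `m[(a ⊗ 1)(κ ⊗ id)(δ(b)(1 ⊗ c))] = a ε(b) c`,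
where `m` is the multiplication and `ε` is the counit. -/
structure IsCoinverse (G : MultiplierHopfStarAlgebra A) (ε : A →ₙₐ[ℂ] ℂ)
    (κ : A →ₗ[ℂ] Multiplier A) : Prop where
  anti : ∀ a b : A, κ (a * b) = κ b * κ a
  right : ∀ a b c : A,
    LinearMap.mul' ℂ A (((leftₗ.flip c) ∘ₗ κ).lTensor A (G.T₂ (a ⊗ₜ b))) = ε b • (a * c)
  left : ∀ a b c : A,
    LinearMap.mul' ℂ A (((rightₗ.flip a) ∘ₗ κ).rTensor A (G.T₁ (b ⊗ₜ c))) = ε b • (a * c)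

end MultiplierHopfStarAlgebra

namespace DiscreteQuantumGroup

theorem left_comul_tmul (G : DiscreteQuantumGroup A) (a b c d : A) :
    (G.comul a).left (b ⊗ₜ (c * d)) = G.T₁ (a ⊗ₜ c) * (b ⊗ₜ[ℂ] d) := by
  have h := congrArg (fun m : Multiplier (A ⊗[ℂ] A) => m.left (b ⊗ₜ[ℂ] d)) (G.T₁_spec a c)
  simpa [tmul] using h.symm

theorem right_comul_tmul (G : DiscreteQuantumGroup A) (a b c d : A) :
    (G.comul a).right ((d * c) ⊗ₜ b) = (d ⊗ₜ[ℂ] b) * G.T₂ (c ⊗ₜ a) := by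
  have h := congrArg (fun m : Multiplier (A ⊗[ℂ] A) => m.right (d ⊗ₜ[ℂ] b)) (G.T₂_spec c a)
  simpa [tmul] using h.symm

/-- The comultiplication of a discrete quantum group is non-degenerate. -/
theorem comul_nondegenerate (G : DiscreteQuantumGroup A) :
    IsNondegenerate (G.comul : A →ₙₐ[ℂ] Multiplier (A ⊗[ℂ] A)) where
  span_left := by
    rw [eq_top_iff]
    intro t _
    obtain ⟨e, -, he⟩ := G.isDirectSum.exists_tensor_localUnit t
    rw [← he]
    suffices h : ∀ s u : A ⊗[ℂ] A, s * u ∈ Submodule.span ℂ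
        {c | ∃ a b, ((G.comul : A →ₙₐ[ℂ] Multiplier (A ⊗[ℂ] A)) a).left b = c} from h t e
    intro s u
    obtain ⟨s, rfl⟩ := G.T₁.surjective s
    induction s with
    | zero => simp
    | add s₁ s₂ h₁ h₂ => simpa [add_mul] using add_mem h₁ h₂
    | tmul a c =>
      induction u with
      | zero => simp
      | add u₁ u₂ h₁ h₂ => simpa [mul_add] using add_mem h₁ h₂
      | tmul b d => exact Submodule.subset_span ⟨a, b ⊗ₜ (c * d), left_comul_tmul G a b c d⟩
  span_right := by
    rw [eq_top_iff]
    intro t _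
    obtain ⟨e, he, -⟩ := G.isDirectSum.exists_tensor_localUnit t
    rw [← he]
    suffices h : ∀ s u : A ⊗[ℂ] A, u * s ∈ Submodule.span ℂ
        {c | ∃ a b, ((G.comul : A →ₙₐ[ℂ] Multiplier (A ⊗[ℂ] A)) a).right b = c} from h t e
    intro s u
    obtain ⟨s, rfl⟩ := G.T₂.surjective s
    induction s with
    | zero => simp
    | add s₁ s₂ h₁ h₂ => simpa [mul_add] using add_mem h₁ h₂
    | tmul c a =>
      induction u with
      | zero => simp
      | add u₁ u₂ h₁ h₂ => simpa [add_mul] using add_mem h₁ h₂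
      | tmul d b => exact Submodule.subset_span ⟨a, (d * c) ⊗ₜ b, right_comul_tmul G a b c d⟩

/-- The extension `δ : M(A) → M(A ⊗ A)` of the comultiplication. -/
def comulExt (G : DiscreteQuantumGroup A) : Multiplier A →ₐ[ℂ] Multiplier (A ⊗[ℂ] A) :=
  extension G.isDirectSum.nondegenerate_tensor G.comul_nondegenerate

/-- The set of almost periodic elements: the `x ∈ M(A)` with `δ(x) ∈ M(A) ⊗ M(A)`. -/
def AP (G : DiscreteQuantumGroup A) : Set (Multiplier A) :=
  {x | G.comulExt x ∈ algTensor (Set.univ : Set (Multiplier A)) (Set.univ : Set (Multiplier A))}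

end DiscreteQuantumGroup

end DiscreteQuantumGroups

end

/-! Coassociativity says that `T₂ ⊗ id` commutes with `id ⊗ T₁`, hence also with `id ⊗ T₁⁻¹`.
Multiplying out the last two legs of this relation gives `x ⊗ m(T₁⁻¹(y ⊗ b)) = m(T₂⁻¹(x ⊗ y)) ⊗ b`
(`tmul_mul'_T₁_symm`), which forces both sides to be a scalar `ε(y)` times `x ⊗ b`; this is the
counit. The coinverse is then given by `κ(a)b = (ε ⊗ id)T₁⁻¹(a ⊗ b)` and `bκ(a) = (id ⊗ ε)T₂⁻¹(b ⊗
a)`, and the same relation shows that these two maps form a multiplier (`mul_antipodeLeft`).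
Uniqueness of `ε` and `κ` holds because `T₂` is onto.

The involution and the local units show that `κ` takes values in `A` and satisfies `κ(κ(b*)*) = b`
(`antipodeLin_star_star`). So `κ` is an antiautomorphism of `A` and extends to `M(A)` by transport
of left and right multiplications. As for Hopf algebras, `δ∘κ` and `(κ ⊗ κ)∘σ∘δ` are both
convolution inverses of `δ`, hence equal (`comul_antipode`). The identity passes to multipliers, so
`κ` preserves almost periodicity.

For `δ(AP) ⊂ AP ⊗ AP`, write `δ(x) = Σ uᵢ ⊗ vᵢ` with independent `vᵢ`. Coassociativity gives `Σ
δ(uᵢ) ⊗ vᵢ = Σ uᵢ ⊗ δ(vᵢ)`, and a functional dual to `vⱼ` on the last leg exhibits `δ(uⱼ)` in `M(A)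
⊗ M(A)` (`left_leg_mem_AP`). Applying `κ` gives the mirror statement (`right_leg_mem_AP`). Using one
and then the other puts both legs in `AP`. -/

noncomputable section

set_option linter.unusedSectionVars false

open Multiplier TensorProduct

/-! ### Local units and separation of tensors -/

section LocalUnits

variable {A : Type*} [NonUnitalRing A] [Module ℂ A] [IsScalarTower ℂ A A] [SMulCommClass ℂ A A]

/-- A direct sum of full matrix algebras has central idempotent local units. -/
theorem IsDirectSumOfMatrixAlgebras.exists_central_localUnit
    (hA : IsDirectSumOfMatrixAlgebras A) (s : Finset A) :
    ∃ e : A, e * e = e ∧ (∀ a, e * a = a * e) ∧ ∀ a ∈ s, e * a = a := by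
  classical
  obtain ⟨I, n, π, -, hinj, hran⟩ := hA
  let F : Set I := ⋃ a ∈ s, {i | π a i ≠ 0}
  have hF : F.Finite := s.finite_toSet.biUnion fun a _ => by
    have : π a ∈ Set.range π := ⟨a, rfl⟩
    rw [hran] at this
    exact this
  let f : (i : I) → Matrix (Fin (n i)) (Fin (n i)) ℂ := fun i => if i ∈ F then 1 else 0
  have hf : f ∈ Set.range π := by
    rw [hran]
    refine hF.subset fun i hi => ?_
    by_contra h
    exact hi (if_neg h)
  obtain ⟨e, he⟩ := hf
  refine ⟨e, hinj ?_, fun a => hinj ?_, fun a ha => hinj ?_⟩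
  · rw [map_mul, he]
    funext i
    by_cases hi : i ∈ F <;> simp [f, hi]
  · rw [map_mul, map_mul, he]
    funext i
    by_cases hi : i ∈ F <;> simp [f, hi]
  · rw [map_mul, he]
    funext i
    by_cases hi : i ∈ F
    · simp [f, hi]
    · have : π a i = 0 := by
        by_contra h
        exact hi (Set.mem_biUnion (show a ∈ (s : Set A) from ha) h)
      simp [f, hi, this]

theorem IsDirectSumOfMatrixAlgebras.exists_rTensor_localUnit
    (hA : IsDirectSumOfMatrixAlgebras A) {V : Type*} [AddCommGroup V] [Module ℂ V]
    (t : A ⊗[ℂ] V) : ∃ e : A, (LinearMap.mulLeft ℂ e).rTensor V t = t := by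
  classical
  suffices h : ∃ s : Finset A, ∀ e : A, (∀ a ∈ s, e * a = a ∧ a * e = a) →
      (LinearMap.mulLeft ℂ e).rTensor V t = t by
    obtain ⟨s, hs⟩ := h
    obtain ⟨e, he⟩ := hA.exists_localUnit s
    exact ⟨e, hs e he⟩
  induction t with
  | zero => exact ⟨∅, fun e _ => by simp⟩
  | tmul a b => exact ⟨{a}, fun e he => by simp [(he a (by simp)).1]⟩
  | add t₁ t₂ h₁ h₂ =>
    obtain ⟨s₁, h₁⟩ := h₁
    obtain ⟨s₂, h₂⟩ := h₂
    refine ⟨s₁ ∪ s₂, fun e he => ?_⟩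
    rw [map_add, h₁ e fun a ha => he a (Finset.mem_union_left _ ha),
      h₂ e fun a ha => he a (Finset.mem_union_right _ ha)]

/-- Elements of `A ⊗ V` are separated by the left multiplications with elements of `A`. -/
theorem IsDirectSumOfMatrixAlgebras.rTensor_mulLeft_ext
    (hA : IsDirectSumOfMatrixAlgebras A) {V : Type*} [AddCommGroup V] [Module ℂ V]
    {s t : A ⊗[ℂ] V}
    (h : ∀ c, (LinearMap.mulLeft ℂ c).rTensor V s = (LinearMap.mulLeft ℂ c).rTensor V t) :
    s = t := by
  obtain ⟨e, he⟩ := hA.exists_rTensor_localUnit (s - t)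
  rw [map_sub, h, sub_self] at he
  exact sub_eq_zero.1 he.symm

/-- Elements of `A ⊗ A` are separated by the right multiplications with elementary tensors. -/
theorem IsDirectSumOfMatrixAlgebras.tensor_ext (hA : IsDirectSumOfMatrixAlgebras A)
    {s t : A ⊗[ℂ] A} (h : ∀ g k : A, s * (g ⊗ₜ[ℂ] k) = t * (g ⊗ₜ[ℂ] k)) : s = t := by
  refine sub_eq_zero.1 (hA.nondegenerate_tensor.eq_zero_of_mul_right _ fun u => ?_)
  induction u with
  | zero => simp
  | add u v hu hv => rw [mul_add, hu, hv, add_zero]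
  | tmul g k => rw [sub_mul, h, sub_self]

theorem lTensor_mulRight_mul (b : A) (s : A ⊗[ℂ] A) (g h : A) :
    (LinearMap.mulRight ℂ b).lTensor A s * (g ⊗ₜ[ℂ] h) = s * (g ⊗ₜ[ℂ] (b * h)) := by
  induction s with
  | zero => simp
  | add s t hs ht => rw [map_add, add_mul, hs, ht, add_mul]
  | tmul x y => simp [mul_assoc]

theorem rTensor_mulRight_mul (b : A) (s : A ⊗[ℂ] A) (g h : A) :
    (LinearMap.mulRight ℂ b).rTensor A s * (g ⊗ₜ[ℂ] h) = s * ((b * g) ⊗ₜ[ℂ] h) := by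
  induction s with
  | zero => simp
  | add s t hs ht => rw [map_add, add_mul, hs, ht, add_mul]
  | tmul x y => simp [mul_assoc]

theorem rTensor_mulLeft_mul (b : A) (s t : A ⊗[ℂ] A) :
    (LinearMap.mulLeft ℂ b).rTensor A s * t = (LinearMap.mulLeft ℂ b).rTensor A (s * t) := by
  induction s with
  | zero => simp
  | add s₁ s₂ hs ht => simp only [map_add, add_mul, hs, ht]
  | tmul x y =>
    induction t with
    | zero => simp
    | add s₁ s₂ hs ht => simp only [map_add, mul_add, hs, ht]
    | tmul g h => simp [mul_assoc]

theorem lTensor_left_mul (hA : NondegenerateProduct A) (m : Multiplier A) (s t : A ⊗[ℂ] A) :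
    m.left.lTensor A s * t = m.left.lTensor A (s * t) := by
  induction s with
  | zero => simp
  | add s₁ s₂ hs ht => simp only [map_add, add_mul, hs, ht]
  | tmul x y =>
    induction t with
    | zero => simp
    | add s₁ s₂ hs ht => simp only [map_add, mul_add, hs, ht]
    | tmul g h => simp [left_mul_apply hA]

end LocalUnits

/-! ### Calculus of `T₁`, `T₂` and coassociativity -/

namespace DiscreteQuantumGroup

variable {A : Type*} [NonUnitalRing A] [Module ℂ A] [IsScalarTower ℂ A A] [SMulCommClass ℂ A A]
  [StarRing A] [StarModule ℂ A] (G : DiscreteQuantumGroup A)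

theorem left_comul_mul (a : A) (s t : A ⊗[ℂ] A) :
    (G.comul a).left (s * t) = (G.comul a).left s * t :=
  left_mul_apply G.isDirectSum.nondegenerate_tensor _ s t

theorem T₂_mul (a b : A) (t : A ⊗[ℂ] A) :
    G.T₂ (a ⊗ₜ b) * t = (LinearMap.mulLeft ℂ a).rTensor A ((G.comul b).left t) := by
  have h := congrArg (fun m : Multiplier (A ⊗[ℂ] A) => m.left t) (G.T₂_spec a b)
  exact h

theorem T₁_mul_left (a b c : A) :
    G.T₁ ((a * b) ⊗ₜ c) = (G.comul a).left (G.T₁ (b ⊗ₜ c)) := by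
  refine G.isDirectSum.tensor_ext fun g k => ?_
  rw [← left_comul_tmul, ← left_comul_mul, ← left_comul_tmul, map_mul, left_mul]

/-- `(c ⊗ 1) (δ(a) (1 ⊗ b)) = ((c ⊗ 1) δ(a)) (1 ⊗ b)`. -/
theorem rTensor_mulLeft_T₁ (c a b : A) :
    (LinearMap.mulLeft ℂ c).rTensor A (G.T₁ (a ⊗ₜ b)) =
      (LinearMap.mulRight ℂ b).lTensor A (G.T₂ (c ⊗ₜ a)) := by
  refine G.isDirectSum.tensor_ext fun g k => ?_
  rw [rTensor_mulLeft_mul, ← left_comul_tmul, lTensor_mulRight_mul, T₂_mul]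

theorem left_comul_tmul_eq (y u v : A) :
    (G.comul y).left (u ⊗ₜ v) = (LinearMap.mulRight ℂ u).rTensor A (G.T₁ (y ⊗ₜ v)) := by
  refine G.isDirectSum.tensor_ext fun g k => ?_
  rw [← left_comul_mul, rTensor_mulRight_mul, ← left_comul_tmul]
  simp

/-- The map `p ⊗ q ↦ T₂(c ⊗ p) ⊗ q`. -/
def T₂rTensor (c : A) : A ⊗[ℂ] A →ₗ[ℂ] A ⊗[ℂ] (A ⊗[ℂ] A) :=
  (TensorProduct.assoc ℂ A A A).toLinearMap ∘ₗ
    (G.T₂.toLinearMap ∘ₗ TensorProduct.mk ℂ A A c).rTensor A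

theorem T₂rTensor_tmul (c p q : A) :
    G.T₂rTensor c (p ⊗ₜ q) = TensorProduct.assoc ℂ A A A (G.T₂ (c ⊗ₜ p) ⊗ₜ q) := rfl

/-- Coassociativity with the first tensor factor turned into a parameter. Every later use of the
axiom goes through this form. -/
theorem T₂rTensor_T₁ (c : A) (s : A ⊗[ℂ] A) :
    G.T₂rTensor c (G.T₁ s) = G.T₁.toLinearMap.lTensor A (G.T₂rTensor c s) := by
  have key : ∀ u : A ⊗[ℂ] A, G.T₂rTensor c u = TensorProduct.assoc ℂ A A A
      (G.T₂.toLinearMap.rTensor A ((TensorProduct.assoc ℂ A A A).symm (c ⊗ₜ u))) := by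
    intro u
    induction u with
    | zero => simp
    | add u v hu hv => rw [map_add, hu, hv, tmul_add]; simp only [map_add]
    | tmul p q => rfl
  have h := G.coassoc ((TensorProduct.assoc ℂ A A A).symm (c ⊗ₜ s))
  rw [LinearEquiv.apply_symm_apply, ← key, LinearMap.lTensor_tmul, LinearEquiv.coe_coe, ← key] at h
  exact h

theorem T₂rTensor_T₁_symm (c : A) (s : A ⊗[ℂ] A) :
    G.T₂rTensor c (G.T₁.symm s) = G.T₁.symm.toLinearMap.lTensor A (G.T₂rTensor c s) := by
  conv_rhs => rw [← G.T₁.apply_symm_apply s, T₂rTensor_T₁]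
  rw [← LinearMap.lTensor_comp_apply]
  simp

/-- On `a ⊗ b` both sides are `(c ⊗ 1)δ(a)(1 ⊗ b)`. -/
theorem lTensor_mul'_T₂rTensor (c : A) (s : A ⊗[ℂ] A) :
    (LinearMap.mul' ℂ A).lTensor A (G.T₂rTensor c s) =
      (LinearMap.mulLeft ℂ c).rTensor A (G.T₁ s) := by
  induction s with
  | zero => simp
  | add s t hs ht => simp only [map_add, hs, ht]
  | tmul a b =>
    rw [rTensor_mulLeft_T₁, T₂rTensor_tmul]
    generalize G.T₂ (c ⊗ₜ a) = u
    induction u with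
    | zero => simp
    | add s t hs ht => rw [add_tmul]; simp only [map_add, hs, ht]
    | tmul x y => simp

end DiscreteQuantumGroup

namespace Multiplier

variable {A : Type*} [NonUnitalRing A] [Module ℂ A] [IsScalarTower ℂ A A] [SMulCommClass ℂ A A]

theorem incl_injective (hA : NondegenerateProduct A) :
    Function.Injective (incl : A → Multiplier A) := by
  intro a b h
  refine sub_eq_zero.1 (hA.eq_zero_of_mul_right _ fun c => ?_)
  rw [sub_mul, sub_eq_zero]
  exact congrArg (fun m : Multiplier A => m.left c) h

theorem incl_star [StarRing A] [StarModule ℂ A] (hA : NondegenerateProduct A) (a : A) :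
    incl (star a) = star (incl a : Multiplier A) :=
  eq_of_left hA (LinearMap.ext fun c => by simp)

end Multiplier

/-! ### The counit -/

namespace DiscreteQuantumGroup

variable {A : Type*} [NonUnitalRing A] [Module ℂ A] [IsScalarTower ℂ A A] [SMulCommClass ℂ A A]
  [StarRing A] [StarModule ℂ A] (G : DiscreteQuantumGroup A)

/-- A linear map on `A ⊗ A` is determined by its values on the tensors `T₁ (a ⊗ b)`. -/
theorem ext_T₁ {V : Type*} [AddCommGroup V] [Module ℂ V] {f g : A ⊗[ℂ] A →ₗ[ℂ] V}
    (h : ∀ a b, f (G.T₁ (a ⊗ₜ b)) = g (G.T₁ (a ⊗ₜ b))) (s : A ⊗[ℂ] A) : f s = g s := by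
  have : f ∘ₗ G.T₁.toLinearMap = g ∘ₗ G.T₁.toLinearMap := TensorProduct.ext' h
  have := LinearMap.congr_fun this (G.T₁.symm s)
  simpa using this

/-- A linear map on `A ⊗ A` is determined by its values on the tensors `T₂ (a ⊗ b)`. -/
theorem ext_T₂ {V : Type*} [AddCommGroup V] [Module ℂ V] {f g : A ⊗[ℂ] A →ₗ[ℂ] V}
    (h : ∀ a b, f (G.T₂ (a ⊗ₜ b)) = g (G.T₂ (a ⊗ₜ b))) (s : A ⊗[ℂ] A) : f s = g s := by
  have : f ∘ₗ G.T₂.toLinearMap = g ∘ₗ G.T₂.toLinearMap := TensorProduct.ext' h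
  have := LinearMap.congr_fun this (G.T₂.symm s)
  simpa using this

/-- For `x ⊗ y = T₂(c ⊗ a)` both sides equal `ca ⊗ b`: on the left, move `T₁⁻¹` across `T₂` by
coassociativity and then multiply the last two legs. Surjectivity of `T₂` gives the general case. -/
theorem tmul_mul'_T₁_symm (x y b : A) :
    x ⊗ₜ[ℂ] LinearMap.mul' ℂ A (G.T₁.symm (y ⊗ₜ b)) =
      LinearMap.mul' ℂ A (G.T₂.symm (x ⊗ₜ y)) ⊗ₜ[ℂ] b := by
  refine G.ext_T₂ (f := (LinearMap.mul' ℂ A ∘ₗ G.T₁.symm.toLinearMap).lTensor A ∘ₗ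
    (TensorProduct.assoc ℂ A A A).toLinearMap ∘ₗ (TensorProduct.mk ℂ (A ⊗[ℂ] A) A).flip b)
    (g := (TensorProduct.mk ℂ A A).flip b ∘ₗ LinearMap.mul' ℂ A ∘ₗ G.T₂.symm.toLinearMap)
    (fun c a => ?_) (x ⊗ₜ y)
  have h := G.lTensor_mul'_T₂rTensor c (G.T₁.symm (a ⊗ₜ b))
  rw [T₂rTensor_T₁_symm, LinearEquiv.apply_symm_apply, ← LinearMap.lTensor_comp_apply,
    T₂rTensor_tmul] at h
  simpa using h

/-- In `tmul_mul'_T₁_symm` the left side has the form `x ⊗ *` and the right side the form `* ⊗ b`,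
so the unknown factors are a common scalar multiple of `b` and of `x`. -/
theorem exists_counit : ∃ ε : A →ₗ[ℂ] ℂ,
    (∀ y b, LinearMap.mul' ℂ A (G.T₁.symm (y ⊗ₜ b)) = ε y • b) ∧
    ∀ x y, LinearMap.mul' ℂ A (G.T₂.symm (x ⊗ₜ y)) = ε y • x := by
  cases subsingleton_or_nontrivial A
  · exact ⟨0, fun _ _ => Subsingleton.elim _ _, fun _ _ => Subsingleton.elim _ _⟩
  obtain ⟨x₀, hx₀⟩ := exists_ne (0 : A)
  obtain ⟨f, hf⟩ := Module.Projective.exists_dual_ne_zero ℂ hx₀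
  -- The scalar is read off by applying `f` to the first leg at `x = x₀`, normalised by `f x₀ ≠ 0`.
  set ε : A →ₗ[ℂ] ℂ := (f x₀)⁻¹ • (f ∘ₗ LinearMap.mul' ℂ A ∘ₗ G.T₂.symm.toLinearMap ∘ₗ
    TensorProduct.mk ℂ A A x₀) with hε
  have h₁ : ∀ y b, LinearMap.mul' ℂ A (G.T₁.symm (y ⊗ₜ b)) = ε y • b := by
    intro y b
    have h := congrArg (fun t => (f x₀)⁻¹ • TensorProduct.lid ℂ A (f.rTensor A t))
      (G.tmul_mul'_T₁_symm x₀ y b)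
    simpa [hε, smul_smul, hf] using h
  refine ⟨ε, h₁, fun x y => ?_⟩
  have h := congrArg (fun t => (f x₀)⁻¹ • TensorProduct.rid ℂ A (f.lTensor A t))
    (G.tmul_mul'_T₁_symm x y x₀)
  simpa [h₁, smul_smul, hf, mul_comm] using h.symm

/-- The counit as a linear functional. -/
def counitLin : A →ₗ[ℂ] ℂ := G.exists_counit.choose

theorem mul'_T₁_symm (y b : A) :
    LinearMap.mul' ℂ A (G.T₁.symm (y ⊗ₜ b)) = G.counitLin y • b :=
  G.exists_counit.choose_spec.1 y b

theorem mul'_T₂_symm (x y : A) :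
    LinearMap.mul' ℂ A (G.T₂.symm (x ⊗ₜ y)) = G.counitLin y • x :=
  G.exists_counit.choose_spec.2 x y

theorem lid_counitLin_eq (s : A ⊗[ℂ] A) :
    TensorProduct.lid ℂ A (G.counitLin.rTensor A s) = LinearMap.mul' ℂ A (G.T₁.symm s) := by
  induction s with
  | zero => simp
  | add s t hs ht => simp only [map_add, hs, ht]
  | tmul y b => simp [mul'_T₁_symm]

theorem rid_counitLin_eq (s : A ⊗[ℂ] A) :
    TensorProduct.rid ℂ A (G.counitLin.lTensor A s) = LinearMap.mul' ℂ A (G.T₂.symm s) := by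
  induction s with
  | zero => simp
  | add s t hs ht => simp only [map_add, hs, ht]
  | tmul y b => simp [mul'_T₂_symm]

theorem lid_counitLin_T₁ (a b : A) :
    TensorProduct.lid ℂ A (G.counitLin.rTensor A (G.T₁ (a ⊗ₜ b))) = a * b := by
  simp [lid_counitLin_eq]

theorem rid_counitLin_T₂ (a b : A) :
    TensorProduct.rid ℂ A (G.counitLin.lTensor A (G.T₂ (a ⊗ₜ b))) = a * b := by
  simp [rid_counitLin_eq]

/-- It suffices to take `s = T₁(b ⊗ c)`, where `δ(a)s = T₁(ab ⊗ c)` and `ε ⊗ id` multiplies the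
legs. -/
theorem lid_counitLin_left_comul (a : A) (s : A ⊗[ℂ] A) :
    TensorProduct.lid ℂ A (G.counitLin.rTensor A ((G.comul a).left s)) =
      a * TensorProduct.lid ℂ A (G.counitLin.rTensor A s) := by
  refine G.ext_T₁ (f := (TensorProduct.lid ℂ A).toLinearMap ∘ₗ G.counitLin.rTensor A ∘ₗ
    (G.comul a).left) (g := LinearMap.mulLeft ℂ a ∘ₗ (TensorProduct.lid ℂ A).toLinearMap ∘ₗ
    G.counitLin.rTensor A) (fun b c => ?_) s
  simp [← T₁_mul_left, lid_counitLin_T₁, mul_assoc]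

/-- The identity `(ε ⊗ id)(s(x ⊗ z)) = ε(x)(ε ⊗ id)(s)z` can be checked on `s = T₁(b ⊗ c)`, where
`s(x ⊗ z) = δ(b)(x ⊗ cz)`. Taking `s = u ⊗ v` with `vz ≠ 0` then isolates the scalars. -/
theorem counitLin_mul (u x : A) : G.counitLin (u * x) = G.counitLin u * G.counitLin x := by
  cases subsingleton_or_nontrivial A
  · simp [Subsingleton.elim u 0]
  have key : ∀ (s : A ⊗[ℂ] A) (z : A),
      TensorProduct.lid ℂ A (G.counitLin.rTensor A (s * (x ⊗ₜ[ℂ] z))) =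
        G.counitLin x • (TensorProduct.lid ℂ A (G.counitLin.rTensor A s) * z) := by
    intro s z
    refine G.ext_T₁ (f := (TensorProduct.lid ℂ A).toLinearMap ∘ₗ G.counitLin.rTensor A ∘ₗ
      LinearMap.mulRight ℂ (x ⊗ₜ[ℂ] z)) (g := G.counitLin x • (LinearMap.mulRight ℂ z ∘ₗ
      (TensorProduct.lid ℂ A).toLinearMap ∘ₗ G.counitLin.rTensor A)) (fun b c => ?_) s
    simp [← left_comul_tmul, lid_counitLin_left_comul, lid_counitLin_T₁, mul_assoc, mul_smul_comm]
  obtain ⟨v, hv⟩ := exists_ne (0 : A)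
  have : ∃ z, v * z ≠ 0 := by
    by_contra! h
    exact hv (G.nondegenerate.eq_zero_of_mul_right v h)
  obtain ⟨z, hz⟩ := this
  have h := key (u ⊗ₜ v) z
  simp only [Algebra.TensorProduct.tmul_mul_tmul, LinearMap.rTensor_tmul, TensorProduct.lid_tmul,
    smul_mul_assoc, smul_smul] at h
  rw [smul_left_injective ℂ hz h, mul_comm]

/-- The counit of a discrete quantum group. -/
def counit : A →ₙₐ[ℂ] ℂ where
  toFun := G.counitLin
  map_smul' := G.counitLin.map_smul
  map_zero' := G.counitLin.map_zero
  map_add' := G.counitLin.map_add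
  map_mul' := G.counitLin_mul

theorem counit_apply (a : A) : G.counit a = G.counitLin a := rfl

theorem isCounit_counit : G.IsCounit G.counit where
  right := G.rid_counitLin_T₂
  left := G.lid_counitLin_T₁

/-- One counit identity determines the functional, even without multiplicativity, since `T₂` is
onto. The generality is needed in `counitLin_star`. -/
theorem counitLin_unique {f : A →ₗ[ℂ] ℂ}
    (hf : ∀ a b, TensorProduct.rid ℂ A (f.lTensor A (G.T₂ (a ⊗ₜ b))) = a * b) :
    f = G.counitLin := by
  cases subsingleton_or_nontrivial A
  · ext a
    rw [Subsingleton.elim a 0, map_zero, map_zero]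
  obtain ⟨x, hx⟩ := exists_ne (0 : A)
  ext a
  have h := G.ext_T₂ (f := (TensorProduct.rid ℂ A).toLinearMap ∘ₗ f.lTensor A)
    (g := (TensorProduct.rid ℂ A).toLinearMap ∘ₗ G.counitLin.lTensor A)
    (fun c d => (hf c d).trans (G.rid_counitLin_T₂ c d).symm) (x ⊗ₜ a)
  simp only [LinearMap.comp_apply, LinearMap.lTensor_tmul, LinearEquiv.coe_coe,
    TensorProduct.rid_tmul] at h
  exact smul_left_injective ℂ hx h

theorem isCounit_unique {ε : A →ₙₐ[ℂ] ℂ} (hε : G.IsCounit ε) : ε = G.counit := by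
  ext a
  exact LinearMap.congr_fun (G.counitLin_unique hε.right) a

/-- `T₂(a ⊗ b)* = δ(b*) (a* ⊗ 1)`. -/
theorem star_T₂_mul (a b g h : A) :
    star (G.T₂ (a ⊗ₜ b)) * (g ⊗ₜ[ℂ] h) = (G.comul (star b)).left ((star a * g) ⊗ₜ h) := by
  rw [map_star, left_star, ← star_injective.eq_iff, star_star, star_mul, star_star]
  simpa using (G.right_comul_tmul b (star h) a (star g)).symm

theorem rid_counitLin_mul (s : A ⊗[ℂ] A) (x y : A) :
    TensorProduct.rid ℂ A (G.counitLin.lTensor A (s * (x ⊗ₜ[ℂ] y))) =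
      G.counitLin y • (TensorProduct.rid ℂ A (G.counitLin.lTensor A s) * x) := by
  induction s with
  | zero => simp
  | add s t hs ht => simp only [map_add, add_mul, hs, ht, smul_add]
  | tmul u v => simp [counitLin_mul, smul_smul, smul_mul_assoc, mul_comm]

theorem mul_rid_counitLin (c : A) (s : A ⊗[ℂ] A) :
    c * TensorProduct.rid ℂ A (G.counitLin.lTensor A s) =
      TensorProduct.rid ℂ A (G.counitLin.lTensor A ((LinearMap.mulLeft ℂ c).rTensor A s)) := by
  induction s with
  | zero => simp
  | add s t hs ht => simp only [map_add, mul_add, hs, ht]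
  | tmul u v => simp [mul_smul_comm]

theorem rid_counitLin_left_comul (a x y : A) :
    TensorProduct.rid ℂ A (G.counitLin.lTensor A ((G.comul a).left (x ⊗ₜ y))) =
      G.counitLin y • (a * x) := by
  refine sub_eq_zero.1 (G.nondegenerate.eq_zero_of_mul_left _ fun c => ?_)
  rw [mul_sub, mul_rid_counitLin, ← T₂_mul, rid_counitLin_mul, rid_counitLin_T₂, mul_assoc,
    mul_smul_comm, sub_self]

theorem exists_counitLin_ne_zero [Nontrivial A] : ∃ y, G.counitLin y ≠ 0 := by
  by_contra! h
  have h0 : G.counitLin = 0 := LinearMap.ext h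
  obtain ⟨v, hv⟩ := exists_ne (0 : A)
  refine hv (G.nondegenerate.eq_zero_of_mul_right v fun z => ?_)
  rw [← rid_counitLin_T₂ G, h0]
  simp

/-- The functional `a ↦ conj ε(a*)` satisfies the counit identity as well, so uniqueness applies. -/
theorem counitLin_star (a : A) : G.counitLin (star a) = star (G.counitLin a) := by
  cases subsingleton_or_nontrivial A
  · simp [Subsingleton.elim a 0]
  obtain ⟨y, hy⟩ := G.exists_counitLin_ne_zero
  let f : A →ₗ[ℂ] ℂ :=
    { toFun := fun a => star (G.counitLin (star a))
      map_smul' := by simp [star_smul]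
      map_add' := by simp }
  have hf : ∀ t, TensorProduct.rid ℂ A (f.lTensor A t) =
      star (TensorProduct.rid ℂ A (G.counitLin.lTensor A (star t))) := by
    intro t
    induction t with
    | zero => simp
    | add s t hs ht => simp only [map_add, star_add, hs, ht]
    | tmul u v => simp [f, star_smul]
  have h := LinearMap.congr_fun (G.counitLin_unique (f := f) fun a b => ?_) a
  · rw [← h]
    simp [f]
  rw [hf, star_eq_iff_star_eq, star_mul, eq_comm, ← sub_eq_zero]
  refine G.nondegenerate.eq_zero_of_mul_right _ fun x => ?_
  rw [sub_mul, sub_eq_zero]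
  -- Here `star (T₂ (a ⊗ b))` is accessible only after right multiplication by `x ⊗ y`, which costs
  -- a factor `ε(y)`; it can be cancelled because `ε(y) ≠ 0`.
  apply smul_right_injective A hy
  simp only
  rw [← rid_counitLin_mul, star_T₂_mul, rid_counitLin_left_comul, mul_assoc]

/-! ### The coinverse on `A` -/

/-- The map `a ⊗ b ↦ κ(a) b`. -/
def antipodeLeft : A ⊗[ℂ] A →ₗ[ℂ] A :=
  (TensorProduct.lid ℂ A).toLinearMap ∘ₗ G.counitLin.rTensor A ∘ₗ G.T₁.symm.toLinearMap

/-- The map `b ⊗ a ↦ b κ(a)`. -/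
def antipodeRight : A ⊗[ℂ] A →ₗ[ℂ] A :=
  (TensorProduct.rid ℂ A).toLinearMap ∘ₗ G.counitLin.lTensor A ∘ₗ G.T₂.symm.toLinearMap

theorem antipodeLeft_T₁ (a b : A) : G.antipodeLeft (G.T₁ (a ⊗ₜ b)) = G.counitLin a • b := by
  simp [antipodeLeft]

theorem antipodeRight_T₂ (a b : A) : G.antipodeRight (G.T₂ (a ⊗ₜ b)) = G.counitLin b • a := by
  simp [antipodeRight]

/-- The counit acts on the middle leg, collapsing `(c ⊗ 1)δ(a)` to `ca`. -/
theorem lTensor_counitLin_T₂rTensor (c : A) (s : A ⊗[ℂ] A) :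
    ((TensorProduct.lid ℂ A).toLinearMap ∘ₗ G.counitLin.rTensor A).lTensor A
      (G.T₂rTensor c s) = (LinearMap.mulLeft ℂ c).rTensor A s := by
  induction s with
  | zero => simp
  | add s t hs ht => simp only [map_add, hs, ht]
  | tmul a b =>
    rw [T₂rTensor_tmul, LinearMap.rTensor_tmul, LinearMap.mulLeft_apply, ← rid_counitLin_T₂ G]
    generalize G.T₂ (c ⊗ₜ a) = u
    induction u with
    | zero => simp
    | add s t hs ht => rw [add_tmul]; simp only [map_add, hs, ht, add_tmul]
    | tmul x y => simp [smul_tmul]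

/-- This is the compatibility that makes `κ(a)` a multiplier. With `c ⊗ a` replaced by `T₂(c ⊗ a)`
both sides become `ε(a)cb`: apply the counit to the middle leg of the relation between `T₂` and
`T₁⁻¹`, then multiply the remaining legs. -/
theorem mul_antipodeLeft (c a b : A) :
    c * G.antipodeLeft (a ⊗ₜ b) = G.antipodeRight (c ⊗ₜ a) * b := by
  refine (G.ext_T₂ (f := LinearMap.mulRight ℂ b ∘ₗ G.antipodeRight)
    (g := LinearMap.mul' ℂ A ∘ₗ G.antipodeLeft.lTensor A ∘ₗ
      (TensorProduct.assoc ℂ A A A).toLinearMap ∘ₗ (TensorProduct.mk ℂ (A ⊗[ℂ] A) A).flip b)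
    (fun c a => ?_) (c ⊗ₜ a)).symm
  have h := congrArg (LinearMap.mul' ℂ A ∘ₗ LinearMap.lTensor A
    ((TensorProduct.lid ℂ A).toLinearMap ∘ₗ G.counitLin.rTensor A))
    (G.T₂rTensor_T₁_symm c (a ⊗ₜ b))
  rw [LinearMap.comp_apply, lTensor_counitLin_T₂rTensor, LinearMap.comp_apply,
    ← LinearMap.lTensor_comp_apply, T₂rTensor_tmul] at h
  have h' : ∀ s : A ⊗[ℂ] A, LinearMap.mul' ℂ A ((LinearMap.mulLeft ℂ c).rTensor A s) =
      c * LinearMap.mul' ℂ A s := by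
    intro s
    induction s with
    | zero => simp
    | add s t hs ht => simp only [map_add, mul_add, hs, ht]
    | tmul u v => simp [mul_assoc]
  rw [h', mul'_T₁_symm] at h
  simp only [LinearMap.comp_apply, antipodeRight_T₂, LinearMap.mulRight_apply, smul_mul_assoc]
  rw [← mul_smul_comm]
  exact h

/-- The coinverse as a map `A → M(A)`. -/
def coinverse : A →ₗ[ℂ] Multiplier A where
  toFun a := Multiplier.mk (G.antipodeLeft ∘ₗ TensorProduct.mk ℂ A A a)
    (G.antipodeRight ∘ₗ (TensorProduct.mk ℂ A A).flip a) fun c b => G.mul_antipodeLeft c a b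
  map_add' a b := Multiplier.ext'
    (LinearMap.ext fun x => by
      change G.antipodeLeft ((a + b) ⊗ₜ x) = G.antipodeLeft (a ⊗ₜ x) + G.antipodeLeft (b ⊗ₜ x)
      rw [add_tmul, map_add])
    (LinearMap.ext fun x => by
      change G.antipodeRight (x ⊗ₜ (a + b)) =
        G.antipodeRight (x ⊗ₜ a) + G.antipodeRight (x ⊗ₜ b)
      rw [tmul_add, map_add])
  map_smul' r a := Multiplier.ext'
    (LinearMap.ext fun x => by
      change G.antipodeLeft ((r • a) ⊗ₜ x) = r • G.antipodeLeft (a ⊗ₜ x)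
      rw [← smul_tmul', map_smul])
    (LinearMap.ext fun x => by
      change G.antipodeRight (x ⊗ₜ (r • a)) = r • G.antipodeRight (x ⊗ₜ a)
      rw [tmul_smul, map_smul])

theorem left_coinverse (a b : A) : (G.coinverse a).left b = G.antipodeLeft (a ⊗ₜ b) := rfl

theorem right_coinverse (a b : A) : (G.coinverse a).right b = G.antipodeRight (b ⊗ₜ a) := rfl

theorem mul'_lTensor_coinverse (c : A) (s : A ⊗[ℂ] A) :
    LinearMap.mul' ℂ A ((leftₗ.flip c ∘ₗ G.coinverse).lTensor A s) = G.antipodeRight s * c := by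
  induction s with
  | zero => simp
  | add s t hs ht => simp only [map_add, add_mul, hs, ht]
  | tmul u v => exact G.mul_antipodeLeft u v c

theorem mul'_rTensor_coinverse (c : A) (s : A ⊗[ℂ] A) :
    LinearMap.mul' ℂ A ((rightₗ.flip c ∘ₗ G.coinverse).rTensor A s) = c * G.antipodeLeft s := by
  induction s with
  | zero => simp
  | add s t hs ht => simp only [map_add, mul_add, hs, ht]
  | tmul u v => exact (G.mul_antipodeLeft c u v).symm

/-- `F(t δ(b)) = ε(b) F(t)` for `F(x ⊗ y) = x κ(y)`. -/
theorem antipodeRight_right_comul (b : A) (s : A ⊗[ℂ] A) :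
    G.antipodeRight ((G.comul b).right s) = G.counitLin b • G.antipodeRight s := by
  refine G.ext_T₂ (f := G.antipodeRight ∘ₗ (G.comul b).right)
    (g := G.counitLin b • G.antipodeRight) (fun x y => ?_) s
  have h : (G.comul b).right (G.T₂ (x ⊗ₜ y)) = G.T₂ (x ⊗ₜ (y * b)) := by
    refine G.isDirectSum.tensor_ext fun g k => ?_
    rw [← central, T₂_mul, T₂_mul, map_mul, left_mul]
  simp [h, antipodeRight_T₂, counitLin_mul, smul_smul, mul_comm]

/-- `H(δ(b) t) = ε(b) H(t)` for `H(x ⊗ y) = κ(x) y`. -/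
theorem antipodeLeft_left_comul (b : A) (s : A ⊗[ℂ] A) :
    G.antipodeLeft ((G.comul b).left s) = G.counitLin b • G.antipodeLeft s := by
  refine G.ext_T₁ (f := G.antipodeLeft ∘ₗ (G.comul b).left)
    (g := G.counitLin b • G.antipodeLeft) (fun x y => ?_) s
  simp [← T₁_mul_left, antipodeLeft_T₁, counitLin_mul, smul_smul]

/-- Both sides are `(u ⊗ a)δ(v)`; the right-hand form lets `antipodeRight_right_comul` extract
`ε(v)`. -/
theorem lTensor_mulLeft_T₂ (a u v : A) :
    (LinearMap.mulLeft ℂ a).lTensor A (G.T₂ (u ⊗ₜ v)) = (G.comul v).right (u ⊗ₜ a) := by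
  refine G.isDirectSum.tensor_ext fun g k => ?_
  have h := lTensor_left_mul G.nondegenerate (incl a) (G.T₂ (u ⊗ₜ v)) (g ⊗ₜ[ℂ] k)
  rw [T₂_mul] at h
  rw [← central]
  refine h.trans ?_
  generalize (G.comul v).left (g ⊗ₜ k) = w
  induction w with
  | zero => simp
  | add s t hs ht => simp only [map_add, mul_add, hs, ht]
  | tmul x y => simp

/-- Let `F(x ⊗ y) = xκ(y)`. The claim `F(x ⊗ ab) = F(F(x ⊗ b) ⊗ a)` is linear in `x ⊗ b`, and at
`T₂(u ⊗ v)` both sides are `ε(v)F(u ⊗ a)`. -/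
theorem coinverse_mul (a b : A) : G.coinverse (a * b) = G.coinverse b * G.coinverse a := by
  have key : ∀ x, (G.coinverse (a * b)).right x = (G.coinverse b * G.coinverse a).right x := by
    intro x
    rw [right_mul, right_coinverse, right_coinverse, right_coinverse]
    refine G.ext_T₂ (f := G.antipodeRight ∘ₗ (LinearMap.mulLeft ℂ a).lTensor A)
      (g := G.antipodeRight ∘ₗ (TensorProduct.mk ℂ A A).flip a ∘ₗ G.antipodeRight)
      (fun u v => ?_) (x ⊗ₜ b)
    simp only [LinearMap.comp_apply, lTensor_mulLeft_T₂, antipodeRight_right_comul,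
      antipodeRight_T₂, map_smul]
    rfl
  refine eq_of_left G.nondegenerate (LinearMap.ext fun c => sub_eq_zero.1
    (G.nondegenerate.eq_zero_of_mul_left _ fun x => ?_))
  rw [mul_sub, central, central, key, sub_self]

theorem isCoinverse_coinverse : G.IsCoinverse G.counit G.coinverse where
  anti := G.coinverse_mul
  right a b c := by
    rw [mul'_lTensor_coinverse, antipodeRight_T₂, smul_mul_assoc, counit_apply]
  left a b c := by
    rw [mul'_rTensor_coinverse, antipodeLeft_T₁, mul_smul_comm, counit_apply]

theorem isCoinverse_unique {κ : A →ₗ[ℂ] Multiplier A} (hκ : G.IsCoinverse G.counit κ) :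
    κ = G.coinverse := by
  refine LinearMap.ext fun a => eq_of_left G.nondegenerate (LinearMap.ext fun c => sub_eq_zero.1
    (G.nondegenerate.eq_zero_of_mul_left _ fun x => ?_))
  rw [mul_sub, sub_eq_zero]
  exact G.ext_T₂ (f := LinearMap.mul' ℂ A ∘ₗ (leftₗ.flip c ∘ₗ κ).lTensor A)
    (g := LinearMap.mul' ℂ A ∘ₗ (leftₗ.flip c ∘ₗ G.coinverse).lTensor A)
    (fun u v => (hκ.right u v c).trans (G.isCoinverse_coinverse.right u v c).symm) (x ⊗ₜ a)

theorem antipodeLeft_mul (s : A ⊗[ℂ] A) (c : A) :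
    G.antipodeLeft s * c = G.antipodeLeft ((LinearMap.mulRight ℂ c).lTensor A s) := by
  induction s with
  | zero => simp
  | add s t hs ht => simp only [map_add, add_mul, hs, ht]
  | tmul x y => exact (left_mul_apply G.nondegenerate (G.coinverse x) y c).symm

/-- At `s = T₂(p ⊗ q)` one has `s* = δ(q*)(p* ⊗ 1)`, so both sides reduce to `ε(q*)κ(p*)`. The right
side visibly lies in `A`; this is what brings the values of `κ` into `A`. -/
theorem coinverse_star_antipodeRight (s : A ⊗[ℂ] A) :
    G.coinverse (star (G.antipodeRight s)) = incl (G.antipodeLeft (star s)) := by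
  obtain ⟨u, rfl⟩ := G.T₂.surjective s
  induction u with
  | zero => simp
  | add s t hs ht => simp only [map_add, star_add, hs, ht]
  | tmul p q =>
    have h : ∀ c, (LinearMap.mulRight ℂ c).lTensor A (star (G.T₂ (p ⊗ₜ q))) =
        (G.comul (star q)).left (star p ⊗ₜ c) := fun c =>
      G.isDirectSum.tensor_ext fun g k => by
        rw [lTensor_mulRight_mul, star_T₂_mul, ← left_comul_mul]
        simp
    refine eq_of_left G.nondegenerate (LinearMap.ext fun c => ?_)
    rw [left_incl, antipodeLeft_mul, h, antipodeLeft_left_comul, antipodeRight_T₂, star_smul,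
      counitLin_star, map_smul]
    rfl

/-- `κ(κ(b*)* a) = κ(a) b`. -/
theorem coinverse_star_coinverse (a b : A) :
    G.coinverse ((star (G.coinverse (star b))).left a) = incl ((G.coinverse a).left b) := by
  rw [left_star, right_coinverse, coinverse_star_antipodeRight]
  simp [left_coinverse]

/-- Elements `κ(u)v` span `A`, because `T₁(y ⊗ a)` is sent to `ε(y)a`, and each of them is a value
of `κ` by `coinverse_star_coinverse`. -/
theorem exists_coinverse_eq_incl (a : A) : ∃ b, G.coinverse b = incl a := by
  cases subsingleton_or_nontrivial A
  · exact ⟨0, by simp [Subsingleton.elim a 0]⟩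
  obtain ⟨y, hy⟩ := G.exists_counitLin_ne_zero
  have ha : a = G.antipodeLeft ((G.counitLin y)⁻¹ • G.T₁ (y ⊗ₜ a)) := by
    rw [map_smul, antipodeLeft_T₁, smul_smul, inv_mul_cancel₀ hy, one_smul]
  rw [ha]
  generalize (G.counitLin y)⁻¹ • G.T₁ (y ⊗ₜ a) = s
  induction s with
  | zero => exact ⟨0, by simp⟩
  | add s t hs ht =>
    obtain ⟨b, hb⟩ := hs
    obtain ⟨c, hc⟩ := ht
    exact ⟨b + c, by rw [map_add, map_add, map_add, hb, hc]⟩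
  | tmul u v => exact ⟨_, G.coinverse_star_coinverse u v⟩

/-- Choose `e` with `ea = a` and `b` with `κ(b) = e*`. Then `κ(a)b* = κ(κ(b)* a) = κ(ea) = κ(a)`,
and the left side is in `A`. -/
theorem exists_incl_eq_coinverse (a : A) : ∃ b, incl b = G.coinverse a := by
  obtain ⟨e, he⟩ := G.isDirectSum.exists_localUnit {a}
  obtain ⟨b, hb⟩ := G.exists_coinverse_eq_incl (star e)
  have h := G.coinverse_star_coinverse a (star b)
  rw [star_star, hb, ← incl_star G.nondegenerate, star_star, left_incl, (he a (by simp)).1] at h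
  exact ⟨_, h.symm⟩

/-- The coinverse as a linear map `A → A`. -/
def antipodeLin : A →ₗ[ℂ] A where
  toFun a := (G.exists_incl_eq_coinverse a).choose
  map_add' a b := incl_injective G.nondegenerate
    ((G.exists_incl_eq_coinverse (a + b)).choose_spec.trans (by
      rw [map_add incl, (G.exists_incl_eq_coinverse a).choose_spec,
        (G.exists_incl_eq_coinverse b).choose_spec, map_add]))
  map_smul' r a := incl_injective G.nondegenerate
    ((G.exists_incl_eq_coinverse (r • a)).choose_spec.trans (by
      rw [map_smul incl, (G.exists_incl_eq_coinverse a).choose_spec, map_smul,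
        RingHom.id_apply]))

theorem incl_antipodeLin (a : A) : incl (G.antipodeLin a) = G.coinverse a :=
  (G.exists_incl_eq_coinverse a).choose_spec

theorem antipodeLin_mul (a b : A) :
    G.antipodeLin (a * b) = G.antipodeLin b * G.antipodeLin a := by
  apply incl_injective G.nondegenerate
  rw [incl_antipodeLin, coinverse_mul, map_mul, incl_antipodeLin, incl_antipodeLin]

/-- By antimultiplicativity `coinverse_star_coinverse` reads `κ(a)κ(κ(b*)*) = κ(a)b`, and `κ(a)`
runs through all of `A`. -/
theorem antipodeLin_star_star (b : A) :
    G.antipodeLin (star (G.antipodeLin (star b))) = b := by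
  refine sub_eq_zero.1 (G.nondegenerate.eq_zero_of_mul_left _ fun c => ?_)
  obtain ⟨a, ha⟩ := G.exists_coinverse_eq_incl c
  rw [← incl_antipodeLin] at ha
  rw [← (incl_injective G.nondegenerate) ha, mul_sub, ← antipodeLin_mul, sub_eq_zero]
  apply incl_injective G.nondegenerate
  have h := G.coinverse_star_coinverse a b
  rw [← incl_antipodeLin G (star b), ← incl_star G.nondegenerate, left_incl,
    ← incl_antipodeLin G a, ← incl_antipodeLin, left_incl] at h
  exact h

/-- The coinverse as a linear bijection `A → A`. -/
def antipode : A ≃ₗ[ℂ] A :=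
  LinearEquiv.ofBijective G.antipodeLin
    ⟨fun a b h => by
      have := congrArg (fun c => star (G.antipodeLin (star c))) h
      have h' : ∀ a, star (G.antipodeLin (star (G.antipodeLin a))) = a := fun a => by
        have := G.antipodeLin_star_star (star a)
        rw [star_star] at this
        rw [this, star_star]
      simpa only [h'] using this,
    fun b => ⟨_, G.antipodeLin_star_star b⟩⟩

theorem incl_antipode (a : A) : incl (G.antipode a) = G.coinverse a := G.incl_antipodeLin a

theorem antipode_mul (a b : A) : G.antipode (a * b) = G.antipode b * G.antipode a :=
  G.antipodeLin_mul a b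

theorem antipodeLeft_tmul (a b : A) : G.antipodeLeft (a ⊗ₜ b) = G.antipode a * b := by
  rw [← left_coinverse, ← incl_antipode, left_incl]

end DiscreteQuantumGroup

/-! ### Extending antiautomorphisms to multiplier algebras -/

namespace Multiplier

section AntiExtension

variable {B : Type*} [NonUnitalRing B] [Module ℂ B] [IsScalarTower ℂ B B] [SMulCommClass ℂ B B]

/-- The extension to multipliers of an antiautomorphism `k` of an algebra. -/
def antiMap (k : B ≃ₗ[ℂ] B) (hk : ∀ a b, k (a * b) = k b * k a) (x : Multiplier B) :
    Multiplier B :=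
  mk (k.toLinearMap ∘ₗ x.right ∘ₗ k.symm.toLinearMap)
    (k.toLinearMap ∘ₗ x.left ∘ₗ k.symm.toLinearMap) fun a b => by
      obtain ⟨a, rfl⟩ := k.surjective a
      obtain ⟨b, rfl⟩ := k.surjective b
      simp [← hk, central]

variable (k : B ≃ₗ[ℂ] B) (hk : ∀ a b, k (a * b) = k b * k a)

theorem left_antiMap (x : Multiplier B) (b : B) :
    (antiMap k hk x).left b = k (x.right (k.symm b)) := rfl

theorem right_antiMap (x : Multiplier B) (b : B) :
    (antiMap k hk x).right b = k (x.left (k.symm b)) := rfl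

theorem symm_anti (hk : ∀ a b, k (a * b) = k b * k a) (a b : B) :
    k.symm (a * b) = k.symm b * k.symm a :=
  k.injective (by simp [hk])

theorem antiMap_incl (b : B) : antiMap k hk (incl b) = incl (k b) :=
  ext' (LinearMap.ext fun c => by simp [left_antiMap, hk])
    (LinearMap.ext fun c => by simp [right_antiMap, hk])

theorem antiMap_symm_antiMap (x : Multiplier B) :
    antiMap k.symm (symm_anti k hk) (antiMap k hk x) = x :=
  ext' (LinearMap.ext fun c => by simp [left_antiMap, right_antiMap])
    (LinearMap.ext fun c => by simp [left_antiMap, right_antiMap])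

theorem antiMap_antiMap_symm (x : Multiplier B) :
    antiMap k hk (antiMap k.symm (symm_anti k hk) x) = x :=
  ext' (LinearMap.ext fun c => by simp [left_antiMap, right_antiMap])
    (LinearMap.ext fun c => by simp [left_antiMap, right_antiMap])

theorem antiMap_mul (x y : Multiplier B) :
    antiMap k hk (x * y) = antiMap k hk y * antiMap k hk x :=
  ext' (LinearMap.ext fun c => by simp [left_antiMap])
    (LinearMap.ext fun c => by simp [right_antiMap])

theorem antiMap_add (x y : Multiplier B) :
    antiMap k hk (x + y) = antiMap k hk x + antiMap k hk y :=
  ext' (LinearMap.ext fun c => by simp [left_antiMap])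
    (LinearMap.ext fun c => by simp [right_antiMap])

theorem antiMap_one : antiMap k hk 1 = 1 :=
  ext' (LinearMap.ext fun c => by simp [left_antiMap])
    (LinearMap.ext fun c => by simp [right_antiMap])

theorem antiMap_smul (r : ℂ) (x : Multiplier B) :
    antiMap k hk (r • x) = r • antiMap k hk x :=
  ext' (LinearMap.ext fun c => by simp [left_antiMap])
    (LinearMap.ext fun c => by simp [right_antiMap])

/-- The extension to multipliers of an antiautomorphism `k` of an algebra, as an isomorphism onto
the opposite algebra. -/
def antiEquiv : Multiplier B ≃ₐ[ℂ] (Multiplier B)ᵐᵒᵖ where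
  toFun x := MulOpposite.op (antiMap k hk x)
  invFun y := antiMap k.symm (symm_anti k hk) y.unop
  left_inv x := antiMap_symm_antiMap k hk x
  right_inv y := congrArg MulOpposite.op (antiMap_antiMap_symm k hk y.unop)
  map_mul' x y := congrArg MulOpposite.op (antiMap_mul k hk x y)
  map_add' x y := congrArg MulOpposite.op (antiMap_add k hk x y)
  commutes' r := by
    rw [Algebra.algebraMap_eq_smul_one, antiMap_smul, antiMap_one, Algebra.algebraMap_eq_smul_one]
    rfl

theorem unop_antiEquiv (x : Multiplier B) : (antiEquiv k hk x).unop = antiMap k hk x := rfl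

/-- Since `bx` lies in `B`, the relation `φ(bx) = φ(x)φ(b)` determines the left action of `φ(x)` on
`φ(B) = B`. -/
theorem antiEquiv_unique (hB : NondegenerateProduct B)
    (φ : Multiplier B ≃ₐ[ℂ] (Multiplier B)ᵐᵒᵖ)
    (hφ : ∀ b, φ (incl b) = MulOpposite.op (incl (k b))) : φ = antiEquiv k hk := by
  refine AlgEquiv.ext fun x => MulOpposite.unop_injective (eq_of_left hB
    (LinearMap.ext fun b => incl_injective hB ?_))
  obtain ⟨b, rfl⟩ := k.surjective b
  have h := congrArg MulOpposite.unop (map_mul φ (incl b) x)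
  rw [incl_mul hB, hφ, hφ, MulOpposite.unop_mul, MulOpposite.unop_op, MulOpposite.unop_op,
    mul_incl hB] at h
  rw [← h, unop_antiEquiv, left_antiMap, LinearEquiv.symm_apply_apply]

end AntiExtension

end Multiplier

/-! ### The pentagon equation and the comultiplication of `κ(a)` -/

namespace DiscreteQuantumGroup

variable {A : Type*} [NonUnitalRing A] [Module ℂ A] [IsScalarTower ℂ A A] [SMulCommClass ℂ A A]
  [StarRing A] [StarModule ℂ A] (G : DiscreteQuantumGroup A)

/-- The antiautomorphism `a ⊗ b ↦ κ(b) ⊗ κ(a)` of `A ⊗ A`. -/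
def flipAntipode : A ⊗[ℂ] A ≃ₗ[ℂ] A ⊗[ℂ] A :=
  (TensorProduct.comm ℂ A A).trans (TensorProduct.congr G.antipode G.antipode)

theorem flipAntipode_tmul (a b : A) :
    G.flipAntipode (a ⊗ₜ b) = G.antipode b ⊗ₜ G.antipode a := rfl

theorem flipAntipode_symm_tmul (a b : A) :
    G.flipAntipode.symm (a ⊗ₜ b) = G.antipode.symm b ⊗ₜ G.antipode.symm a := by
  rw [LinearEquiv.symm_apply_eq, flipAntipode_tmul]
  simp

theorem flipAntipode_mul (s t : A ⊗[ℂ] A) :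
    G.flipAntipode (s * t) = G.flipAntipode t * G.flipAntipode s := by
  induction s with
  | zero => simp
  | add s₁ s₂ h₁ h₂ => simp only [map_add, add_mul, mul_add, h₁, h₂]
  | tmul a b =>
    induction t with
    | zero => simp
    | add t₁ t₂ h₁ h₂ => simp only [map_add, add_mul, mul_add, h₁, h₂]
    | tmul c d => simp [flipAntipode_tmul, antipode_mul]

/-- The linear map `u ⊗ v ↦ T₁₂ T₁₃ (a ⊗ u ⊗ v)`, where `T` is the map `T₁`. -/
def T₁T₁ (a : A) : A ⊗[ℂ] A →ₗ[ℂ] A ⊗[ℂ] (A ⊗[ℂ] A) :=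
  TensorProduct.lift
    (LinearMap.mk₂ ℂ (fun u v => TensorProduct.assoc ℂ A A A
      ((G.T₁.toLinearMap ∘ₗ (TensorProduct.mk ℂ A A).flip u).rTensor A (G.T₁ (a ⊗ₜ v))))
      (fun u u' v => by
        rw [map_add, LinearMap.comp_add, LinearMap.rTensor_add, LinearMap.add_apply, map_add])
      (fun r u v => by
        rw [map_smul, LinearMap.comp_smul, LinearMap.rTensor_smul, LinearMap.smul_apply, map_smul])
      (fun u v v' => by rw [tmul_add]; simp only [map_add])
      (fun r u v => by rw [tmul_smul]; simp only [map_smul]))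

theorem T₁T₁_tmul (a u v : A) :
    G.T₁T₁ a (u ⊗ₜ v) = TensorProduct.assoc ℂ A A A
      ((G.T₁.toLinearMap ∘ₗ (TensorProduct.mk ℂ A A).flip u).rTensor A (G.T₁ (a ⊗ₜ v))) := rfl

/-- The linear map `y ↦ δ(y) t`. -/
def comulApply (t : A ⊗[ℂ] A) : A →ₗ[ℂ] A ⊗[ℂ] A :=
  leftₗ.flip t ∘ₗ ((G.comul : A →ₙₐ[ℂ] Multiplier (A ⊗[ℂ] A)) : A →ₗ[ℂ] Multiplier (A ⊗[ℂ] A))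

theorem comulApply_apply (t : A ⊗[ℂ] A) (y : A) :
    G.comulApply t y = (G.comul y).left t := rfl

/-- Coassociativity once more: `T₁₂T₁₃` amounts to applying `δ` to the second leg of `δ(a)`. The
factor `c` keeps everything inside `A ⊗ A ⊗ A`. -/
theorem rTensor_mulLeft_T₁T₁ (a c : A) (t : A ⊗[ℂ] A) :
    (LinearMap.mulLeft ℂ c).rTensor _ (G.T₁T₁ a t) =
      (G.comulApply t).lTensor A (G.T₂ (c ⊗ₜ a)) := by
  induction t with
  | zero => simp [comulApply]
  | add s t hs ht =>
    rw [map_add, map_add, hs, ht, comulApply, comulApply, comulApply, ← LinearMap.add_apply,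
      ← LinearMap.lTensor_add, ← LinearMap.add_comp, map_add]
  | tmul u v =>
    have h₁ : ∀ s : A ⊗[ℂ] A, (LinearMap.mulLeft ℂ c).rTensor _ (TensorProduct.assoc ℂ A A A
        ((G.T₁.toLinearMap ∘ₗ (TensorProduct.mk ℂ A A).flip u).rTensor A s)) =
        ((LinearMap.mulRight ℂ u).rTensor A).lTensor A (G.T₂rTensor c s) := by
      intro s
      induction s with
      | zero => simp
      | add s t hs ht => simp only [map_add, hs, ht]
      | tmul p q =>
        have := congrArg (fun z => TensorProduct.assoc ℂ A A A (z ⊗ₜ[ℂ] q))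
          (G.rTensor_mulLeft_T₁ c p u)
        rw [T₂rTensor_tmul]
        refine Eq.trans ?_ (this.trans ?_)
        · simp only [LinearMap.rTensor_tmul, LinearMap.comp_apply, LinearMap.flip_apply,
            TensorProduct.mk_apply, LinearEquiv.coe_coe]
          generalize G.T₁ (p ⊗ₜ u) = w
          induction w with
          | zero => simp
          | add s t hs ht => simp only [map_add, add_tmul, hs, ht]
          | tmul x y => simp
        · generalize G.T₂ (c ⊗ₜ p) = w
          induction w with
          | zero => simp
          | add s t hs ht => simp only [map_add, add_tmul, hs, ht]
          | tmul x y => simp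
    rw [T₁T₁_tmul, h₁, T₂rTensor_T₁, T₂rTensor_tmul]
    generalize G.T₂ (c ⊗ₜ a) = w
    induction w with
    | zero => simp
    | add s t hs ht => simp only [map_add, add_tmul, hs, ht]
    | tmul x y => simp [comulApply_apply, left_comul_tmul_eq]

/-- The pentagon equation `T₁₂ T₁₃ T₂₃ = T₂₃ T₁₂` for the map `T = T₁`. -/
theorem T₁T₁_T₁ (a b d : A) :
    G.T₁T₁ a (G.T₁ (b ⊗ₜ d)) =
      G.T₁.toLinearMap.lTensor A (TensorProduct.assoc ℂ A A A (G.T₁ (a ⊗ₜ b) ⊗ₜ d)) := by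
  refine G.isDirectSum.rTensor_mulLeft_ext fun c => ?_
  have h₁ : ∀ s : A ⊗[ℂ] A, (LinearMap.mulLeft ℂ c).rTensor _ (G.T₁.toLinearMap.lTensor A
      (TensorProduct.assoc ℂ A A A (s ⊗ₜ d))) = G.T₁.toLinearMap.lTensor A
      (TensorProduct.assoc ℂ A A A ((LinearMap.mulLeft ℂ c).rTensor A s ⊗ₜ d)) := by
    intro s
    induction s with
    | zero => simp
    | add s t hs ht => simp only [map_add, add_tmul, hs, ht]
    | tmul p q => simp
  rw [rTensor_mulLeft_T₁T₁, h₁, rTensor_mulLeft_T₁]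
  generalize G.T₂ (c ⊗ₜ a) = w
  induction w with
  | zero => simp
  | add s t hs ht => simp only [map_add, add_tmul, hs, ht]
  | tmul x y => simp [comulApply_apply, T₁_mul_left]

/-- The map `a ⊗ t ↦ δ(κ(a)) t`. -/
def comulAntipode : A ⊗[ℂ] (A ⊗[ℂ] A) →ₗ[ℂ] A ⊗[ℂ] A :=
  TensorProduct.lift (leftₗ ∘ₗ
    ((G.comul : A →ₙₐ[ℂ] Multiplier (A ⊗[ℂ] A)) : A →ₗ[ℂ] Multiplier (A ⊗[ℂ] A)) ∘ₗ
    G.antipode.toLinearMap)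

theorem comulAntipode_tmul (a : A) (t : A ⊗[ℂ] A) :
    G.comulAntipode (a ⊗ₜ t) = (G.comul (G.antipode a)).left t := rfl

/-- The antiautomorphism `x ⊗ y ↦ κ(y) ⊗ κ(x)`, extended to `M(A ⊗ A)`. -/
def flipCoinverse : Multiplier (A ⊗[ℂ] A) →ₗ[ℂ] Multiplier (A ⊗[ℂ] A) where
  toFun := antiMap G.flipAntipode G.flipAntipode_mul
  map_add' := antiMap_add _ _
  map_smul' := antiMap_smul _ _

theorem left_flipCoinverse (x : Multiplier (A ⊗[ℂ] A)) (t : A ⊗[ℂ] A) :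
    (G.flipCoinverse x).left t = G.flipAntipode (x.right (G.flipAntipode.symm t)) := rfl

theorem right_flipCoinverse (x : Multiplier (A ⊗[ℂ] A)) (t : A ⊗[ℂ] A) :
    (G.flipCoinverse x).right t = G.flipAntipode (x.left (G.flipAntipode.symm t)) := rfl

/-- The map `a ⊗ t ↦ (κ ⊗ κ)(σ(δ(a))) t`. -/
def flipCoinverseComul : A ⊗[ℂ] (A ⊗[ℂ] A) →ₗ[ℂ] A ⊗[ℂ] A :=
  TensorProduct.lift (leftₗ ∘ₗ G.flipCoinverse ∘ₗ
    ((G.comul : A →ₙₐ[ℂ] Multiplier (A ⊗[ℂ] A)) : A →ₗ[ℂ] Multiplier (A ⊗[ℂ] A)))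

theorem flipCoinverseComul_tmul (a : A) (t : A ⊗[ℂ] A) :
    G.flipCoinverseComul (a ⊗ₜ t) = (G.flipCoinverse (G.comul a)).left t := rfl

/-- In Sweedler notation, `δ(κ(a₁))δ(a₂b)(1 ⊗ d) = ε(a)δ(b)(1 ⊗ d)`, so `δ∘κ` is a convolution
inverse of `δ`. -/
theorem comulAntipode_T₁ (a b d : A) :
    G.comulAntipode (G.T₁.toLinearMap.lTensor A
      (TensorProduct.assoc ℂ A A A (G.T₁ (a ⊗ₜ b) ⊗ₜ d))) =
      G.counitLin a • G.T₁ (b ⊗ₜ d) := by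
  rw [← map_smul, smul_tmul', ← antipodeLeft_T₁]
  generalize G.T₁ (a ⊗ₜ b) = w
  induction w with
  | zero => simp
  | add s t hs ht => simp only [map_add, add_tmul, hs, ht]
  | tmul p q => simp [comulAntipode_tmul, ← T₁_mul_left, antipodeLeft_tmul]

theorem flipCoinverse_comul_tmul (r s q : A) :
    (G.flipCoinverse (G.comul r)).left (s ⊗ₜ G.antipode q) =
      (LinearMap.mulRight ℂ s).rTensor A (G.flipAntipode (G.T₂ (q ⊗ₜ r))) := by
  rw [left_flipCoinverse, flipAntipode_symm_tmul, LinearEquiv.symm_apply_apply,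
    ← lTensor_mulLeft_T₂]
  generalize G.T₂ (q ⊗ₜ r) = w
  induction w with
  | zero => simp
  | add s t hs ht => simp only [map_add, hs, ht]
  | tmul x y => simp [flipAntipode_tmul, antipode_mul]

/-- In Sweedler notation, `κ(p₂)p₃u ⊗ κ(p₁)q = u ⊗ κ(p)q`. -/
theorem flipCoinverseComul_T₁ (p u q : A) :
    G.flipCoinverseComul (TensorProduct.assoc ℂ A A A (G.T₁ (p ⊗ₜ u) ⊗ₜ q)) =
      u ⊗ₜ (G.antipode p * q) := by
  -- Writing the last factor as `κ(q)` turns `κ(p₁)κ(q)` into `κ(qp₁)`, so that `T₂(q ⊗ p)` appears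
  -- and coassociativity can be used.
  obtain ⟨q, rfl⟩ := G.antipode.surjective q
  let Λ : A ⊗[ℂ] (A ⊗[ℂ] A) →ₗ[ℂ] A ⊗[ℂ] A :=
    (TensorProduct.comm ℂ A A).toLinearMap ∘ₗ
      TensorProduct.map G.antipode.toLinearMap G.antipodeLeft
  have h₁ : ∀ s : A ⊗[ℂ] A, G.flipCoinverseComul (TensorProduct.assoc ℂ A A A
      (s ⊗ₜ G.antipode q)) = Λ (G.T₂rTensor q s) := by
    intro s
    induction s with
    | zero => simp
    | add s t hs ht => simp only [map_add, add_tmul, hs, ht]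
    | tmul r s =>
      rw [TensorProduct.assoc_tmul, flipCoinverseComul_tmul, flipCoinverse_comul_tmul,
        T₂rTensor_tmul]
      generalize G.T₂ (q ⊗ₜ r) = w
      induction w with
      | zero => simp
      | add s t hs ht => simp only [map_add, add_tmul, hs, ht]
      | tmul x y => simp [Λ, flipAntipode_tmul, antipodeLeft_tmul]
  rw [h₁, T₂rTensor_T₁, T₂rTensor_tmul, ← antipode_mul, ← rid_counitLin_T₂ G q p]
  generalize G.T₂ (q ⊗ₜ p) = w
  induction w with
  | zero => simp
  | add s t hs ht => simp only [map_add, add_tmul, tmul_add, hs, ht]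
  | tmul x y => simp [Λ, antipodeLeft_T₁]

theorem flipCoinverseComul_T₁T₁ (a : A) (t : A ⊗[ℂ] A) :
    G.flipCoinverseComul (G.T₁T₁ a t) = G.counitLin a • t := by
  induction t with
  | zero => simp
  | add s t hs ht => simp only [map_add, hs, ht, smul_add]
  | tmul u v =>
    rw [T₁T₁_tmul, ← tmul_smul, ← antipodeLeft_T₁]
    generalize G.T₁ (a ⊗ₜ v) = w
    induction w with
    | zero => simp
    | add s t hs ht => simp only [map_add, tmul_add, hs, ht]
    | tmul p q =>
      rw [antipodeLeft_tmul, ← flipCoinverseComul_T₁]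
      simp

/-- On `T₂₃T₁₂(a ⊗ b ⊗ d) = T₁₂T₁₃T₂₃(a ⊗ b ⊗ d)` both maps give `ε(a)T₁(b ⊗ d)`: one is computed
from the first form, the other from the second. As `T₂₃T₁₂` is bijective, the maps agree. -/
theorem comulAntipode_eq : G.comulAntipode = G.flipCoinverseComul := by
  have h : ∀ w : A ⊗[ℂ] (A ⊗[ℂ] A), G.comulAntipode (G.T₁.toLinearMap.lTensor A
      (TensorProduct.assoc ℂ A A A (G.T₁.toLinearMap.rTensor A
        ((TensorProduct.assoc ℂ A A A).symm w)))) =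
      G.flipCoinverseComul (G.T₁.toLinearMap.lTensor A
      (TensorProduct.assoc ℂ A A A (G.T₁.toLinearMap.rTensor A
        ((TensorProduct.assoc ℂ A A A).symm w)))) := by
    intro w
    induction w with
    | zero => simp
    | add s t hs ht => simp only [map_add, hs, ht]
    | tmul a t =>
      induction t with
      | zero => simp
      | add s t hs ht => simp only [map_add, tmul_add, hs, ht]
      | tmul b d =>
        rw [TensorProduct.assoc_symm_tmul, LinearMap.rTensor_tmul, LinearEquiv.coe_coe,
          comulAntipode_T₁, ← T₁T₁_T₁, flipCoinverseComul_T₁T₁]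
  refine LinearMap.ext fun w => ?_
  have h' := h (TensorProduct.assoc ℂ A A A (G.T₁.symm.toLinearMap.rTensor A
    ((TensorProduct.assoc ℂ A A A).symm (G.T₁.symm.toLinearMap.lTensor A w))))
  rw [LinearEquiv.symm_apply_apply, ← LinearMap.rTensor_comp_apply, LinearEquiv.comp_symm,
    LinearMap.rTensor_id_apply, LinearEquiv.apply_symm_apply, ← LinearMap.lTensor_comp_apply,
    LinearEquiv.comp_symm, LinearMap.lTensor_id_apply] at h'
  exact h'

/-- `δ(κ(a)) = (κ ⊗ κ)(σ(δ(a)))`. -/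
theorem comul_antipode (a : A) : G.comul (G.antipode a) = G.flipCoinverse (G.comul a) :=
  eq_of_left G.isDirectSum.nondegenerate_tensor (LinearMap.ext fun t =>
    LinearMap.congr_fun G.comulAntipode_eq (a ⊗ₜ t))

end DiscreteQuantumGroup

/-! ### Tensor products of multipliers, independent legs and slices -/

/-- Expand the second factors in a basis of `V` and collect coefficients. Stating this for a
bilinear map allows either leg to be the independent one, through `flip`. -/
theorem LinearMap.exists_sum_linearIndependent {K M N P : Type*} [Field K] [AddCommGroup M]
    [Module K M] [AddCommGroup N] [Module K N] [AddCommGroup P] [Module K P]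
    (β : M →ₗ[K] N →ₗ[K] P) (U : Submodule K M) (V : Submodule K N) {X : P}
    (hX : X ∈ Submodule.span K (Set.image2 (fun m n => β m n) (U : Set M) (V : Set N))) :
    ∃ (n : ℕ) (x : Fin n → M) (y : Fin n → N),
      (∀ i, x i ∈ U) ∧ (∀ i, y i ∈ V) ∧ LinearIndependent K y ∧ X = ∑ i, β (x i) (y i) := by
  let b := Module.Basis.ofVectorSpace K V
  let Θ : (Module.Basis.ofVectorSpaceIndex K V →₀ U) →ₗ[K] P :=
    Finsupp.lsum K fun i => β.flip (b i) ∘ₗ U.subtype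
  have hΘ : Submodule.span K (Set.image2 (fun m n => β m n) (U : Set M) (V : Set N)) ≤
      LinearMap.range Θ := by
    rw [Submodule.span_le]
    rintro _ ⟨x, hx, y, hy, rfl⟩
    have : ⊤ ≤ (LinearMap.range Θ).comap (β x ∘ₗ V.subtype) := by
      rw [← b.span_eq, Submodule.span_le]
      rintro _ ⟨i, rfl⟩
      exact ⟨Finsupp.single i ⟨x, hx⟩, by simp [Θ]⟩
    exact this (Submodule.mem_top (x := ⟨y, hy⟩))
  obtain ⟨g, rfl⟩ := hΘ hX
  let e := g.support.equivFin.symm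
  refine ⟨_, fun i => g (e i), fun i => b (e i), fun i => (g (e i)).2, fun i => (b (e i)).2,
    ?_, ?_⟩
  · exact (b.linearIndependent.map' V.subtype V.ker_subtype).comp (fun i => (e i : _))
      (Subtype.val_injective.comp e.injective)
  · rw [e.sum_comp (fun i : g.support => β (g i) (b i)),
      Finset.sum_coe_sort g.support (fun i => β (g i) (b i))]
    simp [Θ, Finsupp.sum]

namespace Multiplier

variable {A : Type*} [NonUnitalRing A] [Module ℂ A] [IsScalarTower ℂ A A] [SMulCommClass ℂ A A]

theorem left_tmul (m n : Multiplier A) (t : A ⊗[ℂ] A) :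
    (tmul m n).left t = TensorProduct.map m.left n.left t := rfl

theorem right_tmul (m n : Multiplier A) (t : A ⊗[ℂ] A) :
    (tmul m n).right t = TensorProduct.map m.right n.right t := rfl

/-- The map `(m, n) ↦ m ⊗ n` as a bilinear map. -/
def tmulₗ : Multiplier A →ₗ[ℂ] Multiplier A →ₗ[ℂ] Multiplier (A ⊗[ℂ] A) :=
  LinearMap.mk₂ ℂ tmul
    (fun m m' n => ext' (TensorProduct.map_add_left m.left m'.left n.left)
      (TensorProduct.map_add_left m.right m'.right n.right))
    (fun r m n => ext' (TensorProduct.map_smul_left r m.left n.left)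
      (TensorProduct.map_smul_left r m.right n.right))
    (fun m n n' => ext' (TensorProduct.map_add_right m.left n.left n'.left)
      (TensorProduct.map_add_right m.right n.right n'.right))
    (fun r m n => ext' (TensorProduct.map_smul_right r m.left n.left)
      (TensorProduct.map_smul_right r m.right n.right))

theorem tmul_mul_tmul (m n m' n' : Multiplier A) :
    tmul m n * tmul m' n' = tmul (m * m') (n * n') :=
  ext' (TensorProduct.ext' fun _ _ => rfl) (TensorProduct.ext' fun _ _ => rfl)

theorem tmul_one_one : tmul (1 : Multiplier A) (1 : Multiplier A) = 1 :=
  ext' (TensorProduct.ext' fun _ _ => rfl) (TensorProduct.ext' fun _ _ => rfl)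

theorem star_tmul [StarRing A] [StarModule ℂ A] (m n : Multiplier A) :
    star (tmul m n) = tmul (star m) (star n) :=
  ext' (TensorProduct.ext' fun a b => by simp [left_tmul, right_tmul])
    (TensorProduct.ext' fun a b => by simp [left_tmul, right_tmul])

theorem tmul_mem_algTensor {X Y : Set (Multiplier A)} {m n : Multiplier A} (hm : m ∈ X)
    (hn : n ∈ Y) : tmul m n ∈ algTensor X Y :=
  Submodule.subset_span ⟨m, hm, n, hn, rfl⟩

theorem mul_mem_algTensor_univ {s t : Multiplier (A ⊗[ℂ] A)}
    (hs : s ∈ algTensor (Set.univ : Set (Multiplier A)) (Set.univ : Set (Multiplier A)))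
    (ht : t ∈ algTensor (Set.univ : Set (Multiplier A)) (Set.univ : Set (Multiplier A))) :
    s * t ∈ algTensor (Set.univ : Set (Multiplier A)) (Set.univ : Set (Multiplier A)) := by
  refine Submodule.span_induction₂ (p := fun s t _ _ => s * t ∈ algTensor (Set.univ :
    Set (Multiplier A)) (Set.univ : Set (Multiplier A))) ?_ ?_ ?_ ?_ ?_ ?_ ?_ hs ht
  · rintro _ _ ⟨m, -, n, -, rfl⟩ ⟨m', -, n', -, rfl⟩
    rw [tmul_mul_tmul]
    exact tmul_mem_algTensor trivial trivial
  · intro y _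
    simp
  · intro y _
    simp
  · intro x y z _ _ _ h₁ h₂
    rw [add_mul]
    exact add_mem h₁ h₂
  · intro x y z _ _ _ h₁ h₂
    rw [mul_add]
    exact add_mem h₁ h₂
  · intro r x y _ _ h
    rw [smul_mul_assoc]
    exact Submodule.smul_mem _ _ h
  · intro r x y _ _ h
    rw [mul_smul_comm]
    exact Submodule.smul_mem _ _ h

theorem star_mem_algTensor_univ [StarRing A] [StarModule ℂ A] {s : Multiplier (A ⊗[ℂ] A)}
    (hs : s ∈ algTensor (Set.univ : Set (Multiplier A)) (Set.univ : Set (Multiplier A))) :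
    star s ∈ algTensor (Set.univ : Set (Multiplier A)) (Set.univ : Set (Multiplier A)) := by
  induction hs using Submodule.span_induction with
  | mem x h =>
    obtain ⟨m, -, n, -, rfl⟩ := h
    rw [star_tmul]
    exact tmul_mem_algTensor trivial trivial
  | zero => simp
  | add x y _ _ hx hy =>
    rw [star_add]
    exact add_mem hx hy
  | smul r x _ hx =>
    rw [star_smul]
    exact Submodule.smul_mem _ _ hx

theorem rTensor_mulLeft_left_tmul (c : A) (m n : Multiplier A) (t : A ⊗[ℂ] A) :
    (LinearMap.mulLeft ℂ c).rTensor A ((tmul m n).left t) =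
      n.left.lTensor A ((LinearMap.mulLeft ℂ (m.right c)).rTensor A t) := by
  induction t with
  | zero => simp
  | add s t hs ht => simp only [map_add, hs, ht]
  | tmul a b => simp [left_tmul, central]

theorem left_sum {ι : Type*} (s : Finset ι) (m : ι → Multiplier A) (a : A) :
    (∑ i ∈ s, m i).left a = ∑ i ∈ s, (m i).left a := by
  change leftₗ (∑ i ∈ s, m i) a = _
  rw [map_sum, LinearMap.sum_apply]
  rfl

/-- The slice of `X` by the functional `f(· p)` is again a multiplier. A central idempotent `p` is
used so that left and right slices are compatible. -/
theorem exists_slice (hA : IsDirectSumOfMatrixAlgebras A) (X : Multiplier (A ⊗[ℂ] A))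
    (f : A →ₗ[ℂ] ℂ) {p : A} (hp : p * p = p) (hc : ∀ a, p * a = a * p) :
    ∃ z : Multiplier A, ∀ h,
      z.left h = TensorProduct.rid ℂ A (f.lTensor A (X.left (h ⊗ₜ p))) := by
  have hX := hA.nondegenerate_tensor
  -- As `h ⊗ p = (h ⊗ p)(e ⊗ p)` with `p` central, `X(h ⊗ p)` lies in `A ⊗ pA`. This and its mirror
  -- `h₂` supply the extra factor `p` needed to reduce the claim to `(a ⊗ p)X(b ⊗ p)`.
  have h₁ : ∀ h, X.left (h ⊗ₜ p) = (LinearMap.mulLeft ℂ p).lTensor A (X.left (h ⊗ₜ p)) := by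
    intro h
    obtain ⟨e, he⟩ := hA.exists_localUnit {h}
    have : X.left (h ⊗ₜ p) = X.left (h ⊗ₜ p) * (e ⊗ₜ[ℂ] p) := by
      rw [← left_mul_apply hX]
      simp [hp, (he h (by simp)).2]
    rw [this]
    generalize X.left (h ⊗ₜ p) = s
    induction s with
    | zero => simp
    | add s t hs ht =>
      rw [add_mul, map_add, ← hs, ← ht]
    | tmul x y => simp [hc, mul_assoc, hp]
  have h₂ : ∀ h, X.right (h ⊗ₜ p) = (LinearMap.mulRight ℂ p).lTensor A (X.right (h ⊗ₜ p)) := by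
    intro h
    obtain ⟨e, he⟩ := hA.exists_localUnit {h}
    have : X.right (h ⊗ₜ p) = (e ⊗ₜ[ℂ] p) * X.right (h ⊗ₜ p) := by
      rw [← right_mul_apply hX]
      simp [hp, (he h (by simp)).1]
    rw [this]
    generalize X.right (h ⊗ₜ p) = s
    induction s with
    | zero => simp
    | add s t hs ht =>
      rw [mul_add, map_add, ← hs, ← ht]
    | tmul x y => simp [← hc, ← mul_assoc p p, hp]
  refine ⟨mk ((TensorProduct.rid ℂ A).toLinearMap ∘ₗ f.lTensor A ∘ₗ X.left ∘ₗ
    (TensorProduct.mk ℂ A A).flip p) ((TensorProduct.rid ℂ A).toLinearMap ∘ₗ f.lTensor A ∘ₗ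
    X.right ∘ₗ (TensorProduct.mk ℂ A A).flip p) fun a b => ?_, fun h => rfl⟩
  simp only [LinearMap.comp_apply, LinearMap.flip_apply, TensorProduct.mk_apply,
    LinearEquiv.coe_coe]
  have h := X.central (a ⊗ₜ p) (b ⊗ₜ p)
  have h₃ : ∀ s : A ⊗[ℂ] A, a * TensorProduct.rid ℂ A (f.lTensor A
      ((LinearMap.mulLeft ℂ p).lTensor A s)) =
      TensorProduct.rid ℂ A (f.lTensor A ((a ⊗ₜ[ℂ] p) * s)) := by
    intro s
    induction s with
    | zero => simp
    | add s t hs ht => simp only [map_add, mul_add, hs, ht]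
    | tmul x y => simp [mul_smul_comm]
  have h₄ : ∀ s : A ⊗[ℂ] A, TensorProduct.rid ℂ A (f.lTensor A
      ((LinearMap.mulRight ℂ p).lTensor A s)) * b =
      TensorProduct.rid ℂ A (f.lTensor A (s * (b ⊗ₜ[ℂ] p))) := by
    intro s
    induction s with
    | zero => simp
    | add s t hs ht => simp only [map_add, add_mul, hs, ht]
    | tmul x y => simp [smul_mul_assoc]
  rw [h₁, h₂, h₃, h₄, h]

/-- Linearly independent multipliers are separated by functionals `y ↦ f(y p)` with `p` a central
idempotent. -/
theorem exists_dual_family (hA : IsDirectSumOfMatrixAlgebras A) {n : ℕ}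
    {y : Fin n → Multiplier A} (hy : LinearIndependent ℂ y) (j : Fin n) :
    ∃ (p : A) (f : A →ₗ[ℂ] ℂ), p * p = p ∧ (∀ a, p * a = a * p) ∧
      ∀ i, f ((y i).left p) = (Pi.single j 1 : Fin n → ℂ) i := by
  classical
  have hnd : NondegenerateProduct A :=
    { eq_zero_of_mul_right := fun a h => by
        obtain ⟨e, he⟩ := hA.exists_localUnit {a}
        rw [← (he a (by simp)).2, h]
      eq_zero_of_mul_left := fun a h => by
        obtain ⟨e, he⟩ := hA.exists_localUnit {a}
        rw [← (he a (by simp)).1, h] }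
  let N : Submodule ℂ (Fin n → ℂ) :=
    { carrier := {v | ∃ (p : A) (f : A →ₗ[ℂ] ℂ), p * p = p ∧ (∀ a, p * a = a * p) ∧
        ∀ i, f ((y i).left p) = v i}
      zero_mem' := ⟨0, 0, by simp, by simp, by simp⟩
      smul_mem' := by
        rintro r v ⟨p, f, hp, hc, h⟩
        exact ⟨p, r • f, hp, hc, fun i => by simp [h]⟩
      add_mem' := by
        rintro v w ⟨p, f, hp, hc, h⟩ ⟨q, g, hq, hd, h'⟩
        -- A common `e` dominates both idempotents: from `ep = p` and `eq = q`, the functionals `f(·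
        -- p)` and `g(· q)` take the same values at `yᵢe` as `f` at `yᵢp` and `g` at `yᵢq`.
        obtain ⟨e, he, hec, hes⟩ := hA.exists_central_localUnit {p, q}
        refine ⟨e, f ∘ₗ LinearMap.mulRight ℂ p + g ∘ₗ LinearMap.mulRight ℂ q, he, hec,
          fun i => ?_⟩
        simp [← left_mul_apply hnd, hes p (by simp), hes q (by simp), h, h'] }
  have hN : N = ⊤ := by
    by_contra hN
    -- A nonzero functional vanishing on `N` has coefficients giving a linear combination of the
    -- `yᵢ` that kills every central idempotent, hence is zero; this contradicts independence.
    obtain ⟨φ, hφ, hle⟩ := N.exists_le_ker_of_lt_top (lt_top_iff_ne_top.2 hN)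
    have hsum : ∑ i, φ (Pi.single i 1) • y i = 0 := by
      refine eq_of_left hnd (LinearMap.ext fun a => ?_)
      obtain ⟨e, he, hec, hes⟩ := hA.exists_central_localUnit {a}
      have h0 : (∑ i, φ (Pi.single i 1) • y i).left e = 0 := by
        rw [← Module.forall_dual_apply_eq_zero_iff ℂ]
        intro f
        have hv : (fun i => f ((y i).left e)) ∈ N := ⟨e, f, he, hec, fun i => rfl⟩
        have := hle hv
        rw [LinearMap.mem_ker, LinearMap.pi_apply_eq_sum_univ φ] at this
        rw [left_sum, map_sum, ← this]
        refine Finset.sum_congr rfl fun i _ => ?_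
        simp only [left_smul, map_smul, smul_eq_mul, mul_comm]
        congr 2
        ext k
        simp [Pi.single_apply, eq_comm]
      rw [← hes a (by simp), left_mul_apply hnd, h0]
      simp
    refine hφ (LinearMap.pi_ext' fun i => LinearMap.ext_ring ?_)
    exact Fintype.linearIndependent_iff.1 hy _ hsum i
  have : (Pi.single j 1 : Fin n → ℂ) ∈ N := hN ▸ Submodule.mem_top
  exact this

end Multiplier

/-! ### Almost periodic elements -/

namespace DiscreteQuantumGroup

variable {A : Type*} [NonUnitalRing A] [Module ℂ A] [IsScalarTower ℂ A A] [SMulCommClass ℂ A A]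
  [StarRing A] [StarModule ℂ A] (G : DiscreteQuantumGroup A)

theorem comulExt_incl (a : A) : G.comulExt (incl a) = G.comul a :=
  extension_incl G.isDirectSum.nondegenerate_tensor G.comul_nondegenerate a

/-- Elements of `M(A ⊗ A)` are separated by multiplication with elements of `δ(A)`. -/
theorem mul_comul_ext {X Y : Multiplier (A ⊗[ℂ] A)}
    (h : ∀ a, X * G.comul a = Y * G.comul a) : X = Y :=
  eq_of_left_on_range G.isDirectSum.nondegenerate_tensor G.comul_nondegenerate fun a t =>
    congrArg (fun m : Multiplier (A ⊗[ℂ] A) => m.left t) (h a)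

theorem comulExt_mul_comul (x : Multiplier A) (a : A) :
    G.comulExt x * G.comul a = G.comul (x.left a) := by
  rw [← comulExt_incl, ← map_mul, mul_incl G.nondegenerate, comulExt_incl]

theorem comul_mul_comulExt (x : Multiplier A) (a : A) :
    G.comul a * G.comulExt x = G.comul (x.right a) := by
  rw [← comulExt_incl, ← map_mul, incl_mul G.nondegenerate, comulExt_incl]

theorem comulExt_star (x : Multiplier A) : G.comulExt (star x) = star (G.comulExt x) := by
  refine G.mul_comul_ext fun a => ?_
  rw [comulExt_mul_comul, ← star_injective.eq_iff, star_mul, star_star, ← map_star G.comul,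
    ← map_star G.comul, comul_mul_comulExt, left_star, star_star]

/-- The extension of the coinverse to `M(A)`. -/
def coinverseExt : Multiplier A →ₗ[ℂ] Multiplier A where
  toFun := antiMap G.antipode G.antipode_mul
  map_add' := antiMap_add _ _
  map_smul' := antiMap_smul _ _

theorem coinverseExt_bijective : Function.Bijective G.coinverseExt :=
  ⟨Function.LeftInverse.injective (antiMap_symm_antiMap G.antipode G.antipode_mul),
    Function.RightInverse.surjective (antiMap_antiMap_symm G.antipode G.antipode_mul)⟩

theorem flipCoinverse_injective : Function.Injective G.flipCoinverse :=
  Function.LeftInverse.injective (antiMap_symm_antiMap G.flipAntipode G.flipAntipode_mul)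

theorem flipCoinverse_mul (x y : Multiplier (A ⊗[ℂ] A)) :
    G.flipCoinverse (x * y) = G.flipCoinverse y * G.flipCoinverse x :=
  antiMap_mul G.flipAntipode G.flipAntipode_mul x y

theorem flipCoinverse_tmul (m n : Multiplier A) :
    G.flipCoinverse (tmul m n) = tmul (G.coinverseExt n) (G.coinverseExt m) :=
  ext' (TensorProduct.ext' fun a b => by
      rw [left_flipCoinverse, flipAntipode_symm_tmul]
      rfl)
    (TensorProduct.ext' fun a b => by
      rw [right_flipCoinverse, flipAntipode_symm_tmul]
      rfl)

/-- `δ(κ(x)) = (κ ⊗ κ)(σ(δ(x)))` for multipliers `x`. -/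
theorem comulExt_coinverseExt (x : Multiplier A) :
    G.comulExt (G.coinverseExt x) = G.flipCoinverse (G.comulExt x) := by
  refine G.mul_comul_ext fun a => ?_
  obtain ⟨a, rfl⟩ := G.antipode.surjective a
  rw [comulExt_mul_comul, comul_antipode, ← flipCoinverse_mul, comul_mul_comulExt,
    ← comul_antipode]
  change G.comul (G.antipode (x.right (G.antipode.symm (G.antipode a)))) = _
  rw [LinearEquiv.symm_apply_apply]

theorem map_flipCoinverse_algTensor (U V : Set (Multiplier A)) :
    (algTensor U V).map G.flipCoinverse =
      algTensor (G.coinverseExt '' V) (G.coinverseExt '' U) := by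
  rw [algTensor, algTensor, Submodule.map_span]
  congr 1
  ext X
  constructor
  · rintro ⟨_, ⟨m, hm, n, hn, rfl⟩, rfl⟩
    exact ⟨_, ⟨n, hn, rfl⟩, _, ⟨m, hm, rfl⟩, (G.flipCoinverse_tmul m n).symm⟩
  · rintro ⟨_, ⟨n, hn, rfl⟩, _, ⟨m, hm, rfl⟩, rfl⟩
    exact ⟨_, ⟨m, hm, n, hn, rfl⟩, G.flipCoinverse_tmul m n⟩

theorem mem_AP {x : Multiplier A} : x ∈ G.AP ↔ G.comulExt x ∈
    algTensor (Set.univ : Set (Multiplier A)) (Set.univ : Set (Multiplier A)) := Iff.rfl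

/-- `flipCoinverse` is injective and maps `M(A) ⊗ M(A)` onto itself, and it intertwines `δ(x)` with
`δ(κ(x))`. -/
theorem coinverseExt_mem_AP {x : Multiplier A} : G.coinverseExt x ∈ G.AP ↔ x ∈ G.AP := by
  have h := G.map_flipCoinverse_algTensor Set.univ Set.univ
  rw [Set.image_univ, G.coinverseExt_bijective.surjective.range_eq] at h
  rw [mem_AP, mem_AP, comulExt_coinverseExt]
  nth_rw 1 [← h]
  exact G.flipCoinverse_injective.mem_set_image

theorem image_coinverseExt_AP : G.coinverseExt '' G.AP = G.AP := by
  ext x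
  obtain ⟨x, rfl⟩ := G.coinverseExt_bijective.surjective x
  rw [coinverseExt_mem_AP, G.coinverseExt_bijective.injective.mem_set_image]

/-- The almost periodic elements form a unital `*`-subalgebra. -/
def apStarSubalgebra : StarSubalgebra ℂ (Multiplier A) where
  carrier := G.AP
  mul_mem' {x y} hx hy := by
    rw [mem_AP, map_mul]
    exact mul_mem_algTensor_univ hx hy
  add_mem' {x y} hx hy := by
    rw [mem_AP, map_add]
    exact add_mem hx hy
  algebraMap_mem' r := by
    rw [mem_AP, AlgHom.commutes, Algebra.algebraMap_eq_smul_one, ← tmul_one_one]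
    exact Submodule.smul_mem _ _ (tmul_mem_algTensor trivial trivial)
  star_mem' {x} hx := by
    rw [mem_AP, comulExt_star]
    exact star_mem_algTensor_univ hx

theorem T₁_left (x : Multiplier A) (a b : A) :
    G.T₁ (x.left a ⊗ₜ b) = (G.comulExt x).left (G.T₁ (a ⊗ₜ b)) := by
  refine G.isDirectSum.tensor_ext fun g k => ?_
  rw [← left_comul_tmul, ← left_mul_apply G.isDirectSum.nondegenerate_tensor, ← left_comul_tmul,
    ← comulExt_mul_comul, left_mul]

/-- `δ(x) = Σ xᵢ ⊗ yᵢ` expressed through the map `T₂`. -/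
theorem comulExt_eq_sum_iff {n : ℕ} (x : Multiplier A) (u v : Fin n → Multiplier A) :
    G.comulExt x = ∑ i, tmul (u i) (v i) ↔
      ∀ c a, G.T₂ (c ⊗ₜ x.left a) =
        ∑ i, (v i).left.lTensor A (G.T₂ ((u i).right c ⊗ₜ a)) := by
  have key : ∀ (c a g k : A), (∑ i, (v i).left.lTensor A (G.T₂ ((u i).right c ⊗ₜ a))) *
      (g ⊗ₜ[ℂ] k) = (LinearMap.mulLeft ℂ c).rTensor A
        ((∑ i, tmul (u i) (v i)).left ((G.comul a).left (g ⊗ₜ k))) := by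
    intro c a g k
    rw [Finset.sum_mul, left_sum, map_sum]
    refine Finset.sum_congr rfl fun i _ => ?_
    rw [lTensor_left_mul G.nondegenerate, T₂_mul, rTensor_mulLeft_left_tmul]
  constructor
  · intro h c a
    refine G.isDirectSum.tensor_ext fun g k => ?_
    rw [key, ← h, T₂_mul, ← comulExt_mul_comul, left_mul]
  · intro h
    refine G.mul_comul_ext fun a => eq_of_left G.isDirectSum.nondegenerate_tensor
      (TensorProduct.ext' fun g k => G.isDirectSum.rTensor_mulLeft_ext fun c => ?_)
    rw [comulExt_mul_comul, ← T₂_mul, h, key, left_mul]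

/-- `Σ δ(uᵢ) ⊗ vᵢ = Σ uᵢ ⊗ δ(vᵢ)` if `δ(x) = Σ uᵢ ⊗ vᵢ`. -/
theorem sum_T₂rTensor {n : ℕ} {x : Multiplier A} {u v : Fin n → Multiplier A}
    (h : G.comulExt x = ∑ i, tmul (u i) (v i)) (c : A) (s : A ⊗[ℂ] A) :
    ∑ i, G.T₂rTensor c ((tmul (u i) (v i)).left s) =
      ∑ i, (G.comulExt (v i)).left.lTensor A (G.T₂rTensor ((u i).right c) s) := by
  have h₁ : ∀ (i : Fin n) (w : A ⊗[ℂ] A) (b : A), G.T₁.toLinearMap.lTensor A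
      (TensorProduct.assoc ℂ A A A ((v i).left.lTensor A w ⊗ₜ b)) =
      (G.comulExt (v i)).left.lTensor A (G.T₁.toLinearMap.lTensor A
        (TensorProduct.assoc ℂ A A A (w ⊗ₜ b))) := by
    intro i w b
    induction w with
    | zero => simp
    | add s t hs ht => simp only [map_add, add_tmul, hs, ht]
    | tmul p q => simp [T₁_left]
  -- On `s = T₁(a ⊗ b)` the sum of the `uᵢ ⊗ vᵢ` acts as `δ(x)`, giving `T₁(xa ⊗ b)`; the other side
  -- appears on pushing `T₂` past `T₁` and expanding `T₂(c ⊗ xa)`.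
  obtain ⟨s, rfl⟩ := G.T₁.surjective s
  induction s with
  | zero => simp
  | add s t hs ht => simp only [map_add, Finset.sum_add_distrib, hs, ht]
  | tmul a b =>
    rw [← map_sum, ← left_sum, ← h, ← T₁_left, T₂rTensor_T₁, T₂rTensor_tmul,
      (G.comulExt_eq_sum_iff x u v).1 h, sum_tmul, map_sum, map_sum]
    refine Finset.sum_congr rfl fun i _ => ?_
    rw [h₁, T₂rTensor_T₁, T₂rTensor_tmul]

/-- If `δ(x) = Σ uᵢ ⊗ vᵢ` with linearly independent `vᵢ`, the `uᵢ` are almost periodic. -/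
theorem left_leg_mem_AP {n : ℕ} {x : Multiplier A} {u v : Fin n → Multiplier A}
    (hv : LinearIndependent ℂ v) (h : G.comulExt x = ∑ i, tmul (u i) (v i)) (j : Fin n) :
    u j ∈ G.AP := by
  obtain ⟨p, f, hp, hc, hf⟩ := exists_dual_family G.isDirectSum hv j
  choose z hz using fun i => exists_slice G.isDirectSum (G.comulExt (v i)) f hp hc
  -- The `zᵢ` are the slices of `δ(vᵢ)` by `f(· p)`. This equation is `Σ δ(uᵢ) ⊗ vᵢ = Σ uᵢ ⊗ δ(vᵢ)`
  -- sliced on the last leg, where `f(vᵢp)` is `1` for `i = j` and `0` otherwise.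
  suffices hu : G.comulExt (u j) = ∑ i, tmul (u i) (z i) by
    rw [mem_AP, hu]
    exact Submodule.sum_mem _ fun i _ => tmul_mem_algTensor trivial trivial
  rw [comulExt_eq_sum_iff]
  intro c a
  let Λ : A ⊗[ℂ] (A ⊗[ℂ] A) →ₗ[ℂ] A ⊗[ℂ] A :=
    ((TensorProduct.rid ℂ A).toLinearMap ∘ₗ f.lTensor A).lTensor A
  have h₁ : ∀ (w : A ⊗[ℂ] A) (q : A), Λ (TensorProduct.assoc ℂ A A A (w ⊗ₜ q)) = f q • w := by
    intro w q
    induction w with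
    | zero => simp
    | add s t hs ht => simp only [map_add, add_tmul, hs, ht, smul_add]
    | tmul x y => simp [Λ]
  have h₂ : ∀ (i : Fin n) (w : A ⊗[ℂ] A), Λ ((G.comulExt (v i)).left.lTensor A
      (TensorProduct.assoc ℂ A A A (w ⊗ₜ p))) = (z i).left.lTensor A w := by
    intro i w
    induction w with
    | zero => simp
    | add s t hs ht => simp only [map_add, add_tmul, hs, ht]
    | tmul x y => simp [Λ, hz]
  have h₃ := congrArg Λ (G.sum_T₂rTensor h c (a ⊗ₜ p))
  simp only [map_sum, left_tmul, TensorProduct.map_tmul, T₂rTensor_tmul, h₁, h₂, hf,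
    Pi.single_apply, ite_smul, one_smul, zero_smul, Finset.sum_ite_eq', Finset.mem_univ,
    if_true] at h₃
  exact h₃

/-- If `δ(x) = Σ uᵢ ⊗ vᵢ` with linearly independent `uᵢ`, the `vᵢ` are almost periodic. -/
theorem right_leg_mem_AP {n : ℕ} {x : Multiplier A} {u v : Fin n → Multiplier A}
    (hu : LinearIndependent ℂ u) (h : G.comulExt x = ∑ i, tmul (u i) (v i)) (j : Fin n) :
    v j ∈ G.AP := by
  rw [← coinverseExt_mem_AP]
  refine G.left_leg_mem_AP (x := G.coinverseExt x) (u := fun i => G.coinverseExt (v i))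
    (v := fun i => G.coinverseExt (u i))
    (hu.map' G.coinverseExt (LinearMap.ker_eq_bot.2 G.coinverseExt_bijective.injective)) ?_ j
  -- Since `κ` reverses the legs of `δ`, independence of the `uᵢ` becomes independence of the second
  -- legs of `δ(κ(x))`.
  rw [comulExt_coinverseExt, h, map_sum]
  exact Finset.sum_congr rfl fun i _ => G.flipCoinverse_tmul _ _

/-- Two passes are needed, since a single expansion only guarantees independence of one leg.
Independent second legs first put the first legs in `AP`; re-expanding along a basis of `AP` makes
the first legs independent while keeping them in `AP`, and then the second legs are in `AP` too. -/
theorem comulExt_mem_algTensor_AP {x : Multiplier A} (hx : x ∈ G.AP) :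
    G.comulExt x ∈ algTensor G.AP G.AP := by
  have hx' : G.comulExt x ∈ Submodule.span ℂ (Set.image2 (fun m n => tmulₗ m n)
      ((⊤ : Submodule ℂ (Multiplier A)) : Set (Multiplier A))
      ((⊤ : Submodule ℂ (Multiplier A)) : Set (Multiplier A))) := hx
  obtain ⟨n, u, v, -, -, hv, h⟩ := LinearMap.exists_sum_linearIndependent tmulₗ ⊤ ⊤ hx'
  have hu := G.left_leg_mem_AP hv h
  let S : Submodule ℂ (Multiplier A) := G.apStarSubalgebra.toSubalgebra.toSubmodule
  have h' : G.comulExt x ∈ Submodule.span ℂ (Set.image2 (fun m n => tmulₗ.flip m n)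
      ((⊤ : Submodule ℂ (Multiplier A)) : Set (Multiplier A)) (S : Set (Multiplier A))) := by
    rw [h]
    exact Submodule.sum_mem _ fun i _ => Submodule.subset_span ⟨v i, trivial, u i, hu i, rfl⟩
  obtain ⟨n, v, u, -, hu, hli, h⟩ := LinearMap.exists_sum_linearIndependent tmulₗ.flip ⊤ S h'
  have hv := G.right_leg_mem_AP hli h
  rw [h]
  exact Submodule.sum_mem _ fun i _ => tmul_mem_algTensor (hu i) (hv i)

end DiscreteQuantumGroup

end

theorem mainTheorem2 {A : Type*} [NonUnitalRing A] [Module ℂ A] [IsScalarTower ℂ A A]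
    [SMulCommClass ℂ A A] [StarRing A] [StarModule ℂ A] (G : DiscreteQuantumGroup A) :
    (∃ S : StarSubalgebra ℂ (Multiplier A), (S : Set (Multiplier A)) = G.AP) ∧
    (∀ x ∈ G.AP, G.comulExt x ∈ Multiplier.algTensor G.AP G.AP) ∧
    ∃ (ε : A →ₙₐ[ℂ] ℂ) (κ : A →ₗ[ℂ] Multiplier A)
      (κext : Multiplier A ≃ₐ[ℂ] (Multiplier A)ᵐᵒᵖ),
      (G.IsCounit ε ∧ ∀ ε', G.IsCounit ε' → ε' = ε) ∧
      (G.IsCoinverse ε κ ∧ ∀ κ', G.IsCoinverse ε κ' → κ' = κ) ∧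
      ((∀ a : A, κext (Multiplier.incl a) = MulOpposite.op (κ a)) ∧
        ∀ κext' : Multiplier A ≃ₐ[ℂ] (Multiplier A)ᵐᵒᵖ,
          (∀ a : A, κext' (Multiplier.incl a) = MulOpposite.op (κ a)) → κext' = κext) ∧
      (fun x : Multiplier A => (κext x).unop) '' G.AP = G.AP := by
  refine ⟨⟨G.apStarSubalgebra, rfl⟩, fun x hx => G.comulExt_mem_algTensor_AP hx, G.counit,
    G.coinverse, Multiplier.antiEquiv G.antipode G.antipode_mul,
    ⟨G.isCounit_counit, fun _ h => G.isCounit_unique h⟩,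
    ⟨G.isCoinverse_coinverse, fun _ h => G.isCoinverse_unique h⟩,
    ⟨fun a => ?_, fun φ hφ => ?_⟩, G.image_coinverseExt_AP⟩
  · rw [← G.incl_antipode, ← Multiplier.antiMap_incl G.antipode G.antipode_mul]
    rfl
  · exact Multiplier.antiEquiv_unique G.antipode G.antipode_mul G.nondegenerate φ fun b => by
      rw [hφ, G.incl_antipode]
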